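/- Throughout, $q$ is a prime power and $\mathrm{PG}(m,q)$ is the projective space of the $(m+1)$-dimensional vector space over $\mathbb{F}_q$. We consider non-degenerate classical polar spaces (as point sets) of four types: elliptic and hyperbolic quadrics ($m$ odd), parabolic quadrics ($m$ even), and Hermitian varieties ($q$ a square). A quasi-polar space of a given type in $\mathrm{PG}(m,q)$ is a set $\mathcal{S}$ of points such that every hyperplane meets $\mathcal{S}$ in a number of points which also occurs as the number of points in a hyperplane section of a classical polar space of that type in $\mathrm{PG}(m,q)$. The cone $P\mathcal{B}$ with vertex a point $P$ over a point set $\mathcal{B}$, contained in a subspace not through $P$, consists of $P$ and all points on the lines joining $P$ to points of $\mathcal{B}$ (so $P\emptyset=\{P\}$). A hyperplane $\pi$ is a singular hyperplane of a classical polar space $\mathcal{P}$, with vertex $P$, if $\pi\cap\mathcal{P}$ is a cone $P\mathcal{Q}$, where $\mathcal{Q}$ is a non-degenerate classical polar space of the same type as $\mathcal{P}$ in a hyperplane $\mu$ of $\pi$ not through $P$. A set $\mathcal{P}'$ is obtained from $\mathcal{P}$ by switching in the hyperplane $\pi$ if $\mathcal{P}'=(\mathcal{P}\setminus R)\cup R'$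 for some sets $R,R'$ of points of $\pi$. It is obtained by pivoting if $\pi$ is a singular hyperplane with $\pi\cap\mathcal{P}=P\mathcal{Q}$ as above and $\mathcal{P}'=(\mathcal{P}\setminus P\mathcal{Q})\cup P\mathcal{Q}'$, where $\mathcal{Q}'$ is a quasi-polar space in $\mu$ of the same type as $\mathcal{Q}$. Proposition. Let $m\ge 3$, and let $\mathcal{P}$ be a non-degenerate classical polar space in $\mathrm{PG}(m,q)$ of elliptic, hyperbolic or Hermitian type with $q$ arbitrary, or of parabolic type with $q$ odd. Let $\mathcal{P}'$ be a quasi-polar space (of any type) in $\mathrm{PG}(m,q)$ with $|\mathcal{P}'|=|\mathcal{P}|$, obtained by switching $\mathcal{P}$ in a singular hyperplane $\pi$ of $\mathcal{P}$ with vertex $P$. Then there are a hyperplane $\mu$ of $\pi$ not through $P$ and a quasi-polar space $\mathcal{Q}'$ in $\mu$ of the same type as $\mathcal{P}$, having as many points as a classical polar space of that type in $\mu$, such that $\mathcal{P}'\cap\pi$ is the cone $P\mathcal{Q}'$. Moreover, $\mathcal{P}'$ is obtained from $\mathcal{P}$ by pivoting in $\pi$ with vertex $P$. -/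

import Mathlib

open Module Projectivization
open scoped LinearAlgebra.Projectivization

namespace QuasiPolar

/-- The types of non-symplectic classical polar spaces. -/
inductive PolarType
  | elliptic
  | hyperbolic
  | parabolic
  | hermitian

section

variable {K V : Type*} [Field K] [AddCommGroup V] [Module K V]

/-- The points of the projective space `ℙ K V` on which the quadratic form `Q` vanishes. -/
def quadricPoints (Q : QuadraticForm K V) : Set (ℙ K V) :=
  {p | ∀ v ∈ p.submodule, Q v = 0}

/-- The isotropic points of a sesquilinear form. -/
def isotropicPoints {σ : K →+* K} (B : V →ₛₗ[σ] V →ₗ[K] K) : Set (ℙ K V) :=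
  {p | ∀ v ∈ p.submodule, B v v = 0}

/-- The Witt index of a quadratic form on a finite-dimensional space: the largest dimension of a
totally singular subspace. -/
noncomputable def wittIndex (Q : QuadraticForm K V) : ℕ :=
  sSup {d : ℕ | ∃ U : Submodule K V, (∀ v ∈ U, Q v = 0) ∧ finrank K U = d}

/-- `S` is the point set of a non-degenerate classical polar space of the given type, where `V` is
a finite-dimensional vector space over a finite field `K`. A quadratic form is non-degenerate
(in any characteristic) if no nonzero singular vector is orthogonal to the whole space. -/
def IsClassicalPolarSpace : PolarType → Set (ℙ K V) → Prop
  | .elliptic, S => ∃ Q : QuadraticForm K V, Q.radical = ⊥ ∧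
      finrank K V = 2 * (wittIndex Q + 1) ∧ S = quadricPoints Q
  | .hyperbolic, S => ∃ Q : QuadraticForm K V, Q.radical = ⊥ ∧
      finrank K V = 2 * wittIndex Q ∧ S = quadricPoints Q
  | .parabolic, S => ∃ Q : QuadraticForm K V, Q.radical = ⊥ ∧
      finrank K V = 2 * wittIndex Q + 1 ∧ S = quadricPoints Q
  | .hermitian, S => ∃ (σ : K →+* K) (B : V →ₛₗ[σ] V →ₗ[K] K),
      σ ≠ RingHom.id K ∧ σ.comp σ = RingHom.id K ∧
      B.IsSymm ∧ B.Nondegenerate ∧ S = isotropicPoints B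

/-- A quasi-polar space of type `T`: every hyperplane meets `S` in a number of points that occurs
as the size of a hyperplane section of a classical polar space of type `T` in the same projective
space. -/
def IsQuasiPolarSpace (T : PolarType) (S : Set (ℙ K V)) : Prop :=
  ∃ S₀ : Set (ℙ K V), IsClassicalPolarSpace T S₀ ∧
    ∀ H : Submodule K V, IsCoatom H → ∃ H₀ : Submodule K V, IsCoatom H₀ ∧
      (S ∩ H.projectivization).ncard = (S₀ ∩ H₀.projectivization).ncard

/-- The cone with vertex `P` whose base is the point set `B` of the projective subspace given
by `W`: the point `P` together with the points of the lines joining `P` to the points of `B`. -/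
def cone (P : ℙ K V) (W : Submodule K V) (B : Set (ℙ K W)) : Set (ℙ K V) :=
  {P} ∪ {R | ∃ b ∈ B, R.submodule ≤
    P.submodule ⊔ (Projectivization.map W.subtype W.injective_subtype b).submodule}

/-- `P` is a point of (the projective subspace given by) `π`, and `W` gives a hyperplane of `π`
not through `P`. -/
def IsBaseSpace (π : Submodule K V) (P : ℙ K V) (W : Submodule K V) : Prop :=
  Disjoint W P.submodule ∧ W ⊔ P.submodule = π

/-- `π` is a singular hyperplane with vertex `P` of the classical polar space `S` of type `T`:
it meets `S` in a cone with vertex `P` over a classical polar space of type `T`. -/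
def IsSingularHyperplane (T : PolarType) (S : Set (ℙ K V)) (π : Submodule K V) (P : ℙ K V) :
    Prop :=
  IsCoatom π ∧ ∃ W : Submodule K V, IsBaseSpace π P W ∧
    ∃ B : Set (ℙ K W), IsClassicalPolarSpace T B ∧ S ∩ π.projectivization = cone P W B

/-- `S'` is obtained from `S` by switching in the hyperplane `π`: a set `R` of points of `π` is
replaced by a set `R'` of points of `π`. -/
def IsSwitching (S S' : Set (ℙ K V)) (π : Submodule K V) : Prop :=
  ∃ R R' : Set (ℙ K V), R ⊆ π.projectivization ∧ R' ⊆ π.projectivization ∧ S' = (S \ R) ∪ R'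

/-- `S'` is obtained by pivoting the polar space `S` of type `T` in its singular hyperplane `π`
with vertex `P`: the cone `S ∩ π` with vertex `P` over a polar space `B` of type `T` is replaced
by the cone with vertex `P` over a quasi-polar space `B'` of type `T`. -/
def IsPivoting (T : PolarType) (S S' : Set (ℙ K V)) (π : Submodule K V) (P : ℙ K V) : Prop :=
  ∃ W : Submodule K V, IsBaseSpace π P W ∧ ∃ B B' : Set (ℙ K W),
    IsClassicalPolarSpace T B ∧ S ∩ π.projectivization = cone P W B ∧
    IsQuasiPolarSpace T B' ∧ S' = (S \ cone P W B) ∪ cone P W B'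

end

end QuasiPolar

/-! Let `e` span the vertex P, so that π is the hyperplane orthogonal to `e`. The size of the
section of the polar space with `y⊥` depends only on the value at `y` of the quadratic or Hermitian
form (`IsPolarModel`, established by Gauss sums). If `y` is not orthogonal to `e`, the hyperplanes
`(y + c e)⊥` all have the same trace on π, while the form takes every value on the vectors `y + c
e`. Switching therefore shifts all the section sizes A of the polar space by one number d, and A + d
lies in the set A' of sizes allowed for the new set. As A' is no larger than A, the translate is all
of A', so d is the same for every hyperplane not through P (`eq_of_forall_add_mem`).

Fourier inversion now applies to the difference of the two indicator functions: its coefficients off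
`e⊥` are constant, which forces d = 0 and invariance under translation by `e`
(`eq_zero_and_indicator_translate`). Hence the new set meets π in a cone with vertex P, and A = A'.

For the base of this cone, take a hyperplane through P other than π. Its section of the polar space
has a part outside π of constant size (`ncard_mul_ncard_diff`), and switching does not change that
part. Since A' = A, some hyperplane through P has the same section size for the old set; subtracting
the outer parts shows that section sizes of the new base occur for the old one (`exists_cone`).

The inequality of the sizes of A' and A needs care only if the new set is parabolic: parity of the
dimension excludes elliptic and hyperbolic originals, and a point count excludes Hermitian ones
(`ncard_ne_of_hermitian_of_parabolic`). -/

namespace QuasiPolar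

/-! ### Additive characters on vector spaces over a finite field -/

section Fourier

variable {k : Type*} [Field k] {ψ : AddChar k ℂ}

theorem sum_addChar_comp_eq_zero {A : Type*} [AddCommGroup A] [Fintype A] (f : A →+ k)
    (hf : ∃ a, ψ (f a) ≠ 1) : ∑ a, ψ (f a) = 0 := by
  have h : ψ.compAddMonoidHom f ≠ 0 := by
    obtain ⟨a, ha⟩ := hf
    intro h
    exact ha (by simpa using DFunLike.congr_fun h a)
  simpa using AddChar.sum_eq_zero_iff_ne_zero.2 h

variable {V : Type*} [AddCommGroup V] [Module k V]

theorem exists_addChar_linearMap_ne_one (hψ : ψ ≠ 1) {f : V →ₗ[k] k} (hf : f ≠ 0) :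
    ∃ v, ψ (f v) ≠ 1 := by
  obtain ⟨c, hc⟩ := AddChar.ne_one_iff.1 hψ
  obtain ⟨v, hv⟩ := LinearMap.surjective hf c
  exact ⟨v, by rwa [hv]⟩

theorem sum_addChar_linearMap [Fintype V] (hψ : ψ ≠ 1) {f : V →ₗ[k] k} (hf : f ≠ 0) :
    ∑ v, ψ (f v) = 0 :=
  sum_addChar_comp_eq_zero f.toAddMonoidHom (exists_addChar_linearMap_ne_one hψ hf)

theorem sum_addChar_mul [Fintype k] (hψ : ψ ≠ 1) {b : k} (hb : b ≠ 0) : ∑ t, ψ (t * b) = 0 := by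
  have := sum_addChar_linearMap (V := k) hψ (f := LinearMap.mul k k b)
    (fun h ↦ hb (by simpa using DFunLike.congr_fun h 1))
  simpa [mul_comm] using this

open scoped Classical in
theorem sum_dual_addChar [FiniteDimensional k V] [Fintype (Dual k V)] (hψ : ψ ≠ 1) (x : V) :
    ∑ φ : Dual k V, ψ (φ x) = if x = 0 then (Fintype.card (Dual k V) : ℂ) else 0 := by
  split_ifs with h
  · simp [h]
  · refine sum_addChar_linearMap (V := Dual k V) (f := Dual.eval k V x) hψ ?_
    rwa [Ne, Module.eval_apply_eq_zero_iff]

theorem exists_addChar_ne_one (k : Type*) [Field k] [Finite k] : ∃ ψ : AddChar k ℂ, ψ ≠ 1 := by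
  refine ⟨AddChar.FiniteField.primitiveChar_to_Complex k, fun h ↦ ?_⟩
  have := AddChar.FiniteField.primitiveChar_to_Complex_isPrimitive k
  exact this one_ne_zero (by rw [h]; ext; simp)

end Fourier

/-! ### Exponential sums of quadratic forms -/

section Gauss

variable {k : Type*} [Field k] {ψ : AddChar k ℂ} {V : Type*} [AddCommGroup V] [Module k V]

theorem polarBilin_ne_zero {Q : QuadraticForm k V}
    (hQ : ∀ y, (∀ x, QuadraticMap.polar Q y x = 0) → y = 0) {y : V} (hy : y ≠ 0) :
    Q.polarBilin y ≠ 0 :=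
  fun h ↦ hy (hQ y fun x ↦ by simpa using DFunLike.congr_fun h x)

variable [Fintype V]

/-- The exponential sum `∑ ψ(t Q(v))` of a quadratic form. -/
noncomputable def quadraticSum (ψ : AddChar k ℂ) (Q : QuadraticForm k V) (t : k) : ℂ :=
  ∑ v, ψ (t * Q v)

/-- Completing the square: the shift of `v` by `t⁻¹ • y` absorbs the linear character. -/
theorem sum_addChar_add_polar (Q : QuadraticForm k V) {t : k} (ht : t ≠ 0) (y : V) :
    ∑ v, ψ (t * Q v) * ψ (QuadraticMap.polar Q y v) =
      quadraticSum ψ Q t * ψ (-(t⁻¹ * Q y)) := by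
  rw [quadraticSum, ← Equiv.sum_comp (Equiv.addRight (t⁻¹ • y)) fun v ↦ ψ (t * Q v), Finset.sum_mul]
  refine Finset.sum_congr rfl fun v _ ↦ ?_
  rw [← AddChar.map_add_eq_mul, ← AddChar.map_add_eq_mul]
  congr 1
  have h := QuadraticMap.map_add Q v (t⁻¹ • y)
  simp only [Equiv.coe_addRight, h, QuadraticMap.map_smul, QuadraticMap.polar_smul_right,
    QuadraticMap.polar_comm Q v y, smul_eq_mul]
  field_simp
  ring

variable [Fintype k]

open scoped Classical in
-- Summing `ψ (t * Q v)` over all `t` detects `Q v = 0`; the term `t = 0` is split off.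
theorem card_mul_sum_isotropic (hψ : ψ ≠ 1) (Q : QuadraticForm k V) (g : V → ℂ) :
    (Fintype.card k : ℂ) * ∑ v with Q v = 0, g v =
      ∑ v, g v + ∑ t ∈ Finset.univ.erase (0 : k), ∑ v, ψ (t * Q v) * g v := by
  have h1 : ∑ v, g v = ∑ v, ψ (0 * Q v) * g v := by simp
  rw [h1, Finset.add_sum_erase _ (fun t : k ↦ ∑ v, ψ (t * Q v) * g v) (Finset.mem_univ 0),
    Finset.sum_comm, Finset.mul_sum, Finset.sum_filter]
  refine Finset.sum_congr rfl fun v _ ↦ ?_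
  rw [← Finset.sum_mul]
  split_ifs with h
  · simp [h]
  · simp [sum_addChar_mul hψ h]

open scoped Classical in
theorem card_mul_sum_isotropic_polar (hψ : ψ ≠ 1) {Q : QuadraticForm k V}
    (hQ : ∀ y, (∀ x, QuadraticMap.polar Q y x = 0) → y = 0) {y : V} (hy : y ≠ 0) :
    (Fintype.card k : ℂ) * ∑ v with Q v = 0, ψ (QuadraticMap.polar Q y v) =
      ∑ t ∈ Finset.univ.erase (0 : k), quadraticSum ψ Q t * ψ (-(t⁻¹ * Q y)) := by
  rw [card_mul_sum_isotropic hψ]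
  have := sum_addChar_linearMap hψ (polarBilin_ne_zero hQ hy)
  simp only [QuadraticMap.polarBilin_apply_apply] at this
  rw [this, zero_add]
  refine Finset.sum_congr rfl fun t ht ↦ ?_
  rw [sum_addChar_add_polar Q (Finset.ne_of_mem_erase ht)]

open scoped Classical in
theorem card_mul_card_isotropic (hψ : ψ ≠ 1) (Q : QuadraticForm k V) :
    (Fintype.card k : ℂ) * {v | Q v = 0}.ncard =
      Fintype.card V + ∑ t ∈ Finset.univ.erase (0 : k), quadraticSum ψ Q t := by
  have := card_mul_sum_isotropic hψ Q fun _ ↦ 1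
  simp only [mul_one, Finset.sum_const, nsmul_eq_mul, Finset.card_univ] at this
  rw [Set.ncard_eq_toFinset_card', Set.toFinset_ofPred]
  exact this

open ComplexConjugate in
-- In the double sum over `(v + w, w)`, the inner sum over `w` is that of a nontrivial character
-- unless `v = 0`. This yields both the nonvanishing of the sum and its absolute value.
theorem quadraticSum_mul_conj (hψ : ψ ≠ 1) {Q : QuadraticForm k V}
    (hQ : ∀ y, (∀ x, QuadraticMap.polar Q y x = 0) → y = 0) {t : k} (ht : t ≠ 0) :
    quadraticSum ψ Q t * conj (quadraticSum ψ Q t) = Fintype.card V := by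
  classical
  have h1 : ∀ v w, ψ (t * Q (v + w)) * conj (ψ (t * Q w)) =
      ψ (t * Q v) * ψ ((t • Q.polarBilin v) w) := fun v w ↦ by
    rw [← AddChar.map_neg_eq_conj, ← AddChar.map_add_eq_mul, ← AddChar.map_add_eq_mul]
    congr 1
    simp only [QuadraticMap.map_add Q, LinearMap.smul_apply, QuadraticMap.polarBilin_apply_apply,
      smul_eq_mul]
    ring
  rw [quadraticSum, map_sum, Finset.sum_mul_sum, Finset.sum_comm]
  calc _ = ∑ w, ∑ v, ψ (t * Q (v + w)) * conj (ψ (t * Q w)) :=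
        Finset.sum_congr rfl fun w _ ↦
          (Equiv.sum_comp (Equiv.addRight w) fun v ↦ ψ (t * Q v) * conj (ψ (t * Q w))).symm
    _ = ∑ v, ψ (t * Q v) * ∑ w, ψ ((t • Q.polarBilin v) w) := by
        rw [Finset.sum_comm]
        simp_rw [h1, Finset.mul_sum]
    _ = ∑ v : V, if v = 0 then (Fintype.card V : ℂ) else 0 := by
        refine Finset.sum_congr rfl fun v _ ↦ ?_
        split_ifs with h
        · simp [h]
        · rw [sum_addChar_linearMap hψ (smul_ne_zero ht (polarBilin_ne_zero hQ h)), mul_zero]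
    _ = Fintype.card V := by simp

theorem quadraticSum_ne_zero (hψ : ψ ≠ 1) {Q : QuadraticForm k V}
    (hQ : ∀ y, (∀ x, QuadraticMap.polar Q y x = 0) → y = 0) {t : k} (ht : t ≠ 0) :
    quadraticSum ψ Q t ≠ 0 := fun h ↦ by
  have := quadraticSum_mul_conj hψ hQ ht
  rw [h, zero_mul] at this
  exact Fintype.card_ne_zero (α := V) (by exact_mod_cast this.symm)

end Gauss

end QuasiPolar


namespace QuasiPolar

/-! ### From point sets to scale-invariant sets of vectors -/

section Vectors

variable {K V : Type*} [Field K] [AddCommGroup V] [Module K V]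

/-- The vectors spanning a point of `S`, together with zero. -/
def vectors (S : Set (ℙ K V)) : Set V :=
  {v | ∀ hv : v ≠ 0, Projectivization.mk K v hv ∈ S}

theorem zero_mem_vectors (S : Set (ℙ K V)) : (0 : V) ∈ vectors S := fun h ↦ absurd rfl h

theorem mk_mem_iff_mem_vectors {S : Set (ℙ K V)} {v : V} (hv : v ≠ 0) :
    Projectivization.mk K v hv ∈ S ↔ v ∈ vectors S :=
  ⟨fun h _ ↦ h, fun h ↦ h hv⟩

theorem rep_mem_vectors_iff {S : Set (ℙ K V)} {p : ℙ K V} : p.rep ∈ vectors S ↔ p ∈ S := by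
  rw [← mk_mem_iff_mem_vectors p.rep_nonzero, mk_rep]

theorem smul_mem_vectors_iff {S : Set (ℙ K V)} {c : K} (hc : c ≠ 0) {v : V} :
    c • v ∈ vectors S ↔ v ∈ vectors S := by
  rcases eq_or_ne v 0 with rfl | hv
  · simp
  rw [← mk_mem_iff_mem_vectors hv, ← mk_mem_iff_mem_vectors (smul_ne_zero hc hv)]
  have : Projectivization.mk K (c • v) (smul_ne_zero hc hv) = Projectivization.mk K v hv :=
    (mk_eq_mk_iff' K _ _ _ _).2 ⟨c, rfl⟩
  rw [this]

theorem vectors_injective : Function.Injective (vectors : Set (ℙ K V) → Set V) :=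
  fun S S' h ↦ by
    ext p
    rw [← rep_mem_vectors_iff, h, rep_mem_vectors_iff]

theorem vectors_inter_projectivization (S : Set (ℙ K V)) (H : Submodule K V) :
    vectors (S ∩ H.projectivization) = vectors S ∩ H := by
  ext v
  rcases eq_or_ne v 0 with rfl | hv
  · simp [zero_mem_vectors]
  · simp only [← mk_mem_iff_mem_vectors hv, Set.mem_inter_iff, SetLike.mem_coe]
    rfl

theorem vectors_quadricPoints (Q : QuadraticForm K V) :
    vectors (quadricPoints Q) = {v | Q v = 0} := by
  ext v
  rcases eq_or_ne v 0 with rfl | hv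
  · simp [zero_mem_vectors]
  rw [← mk_mem_iff_mem_vectors hv, quadricPoints, Set.mem_ofPred_eq, submodule_mk]
  refine ⟨fun h ↦ h v (Submodule.mem_span_singleton_self v), fun h w hw ↦ ?_⟩
  obtain ⟨c, rfl⟩ := Submodule.mem_span_singleton.1 hw
  rw [Set.mem_ofPred_eq] at h
  rw [QuadraticMap.map_smul, h, smul_zero]

theorem vectors_isotropicPoints {σ : K →+* K} (B : V →ₛₗ[σ] V →ₗ[K] K) :
    vectors (isotropicPoints B) = {v | B v v = 0} := by
  ext v
  rcases eq_or_ne v 0 with rfl | hv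
  · simp [zero_mem_vectors]
  rw [← mk_mem_iff_mem_vectors hv, isotropicPoints, Set.mem_ofPred_eq, submodule_mk]
  refine ⟨fun h ↦ h v (Submodule.mem_span_singleton_self v), fun h w hw ↦ ?_⟩
  obtain ⟨c, rfl⟩ := Submodule.mem_span_singleton.1 hw
  rw [Set.mem_ofPred_eq] at h
  simp [h]

/-- Each point carries q - 1 nonzero vectors; the final 1 counts the zero vector. -/
theorem ncard_vectors [Finite K] [Finite V] (S : Set (ℙ K V)) :
    (vectors S).ncard = S.ncard * (Nat.card K - 1) + 1 := by
  classical
  have h1 : vectors S = insert 0 {v | ∃ hv : v ≠ 0, Projectivization.mk K v hv ∈ S} := by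
    ext v
    rcases eq_or_ne v 0 with rfl | hv <;> simp [zero_mem_vectors, *, ← mk_mem_iff_mem_vectors]
  have h2 : {v : V | ∃ hv : v ≠ 0, Projectivization.mk K v hv ∈ S} =
      (fun x : ℙ K V × Kˣ ↦ (x.2 : K) • x.1.rep) '' (S ×ˢ Set.univ) := by
    ext v
    simp only [Set.mem_ofPred_eq, Set.mem_image, Set.mem_prod, Set.mem_univ, and_true, Prod.exists]
    constructor
    · rintro ⟨hv, h⟩
      obtain ⟨a, ha⟩ := exists_smul_eq_mk_rep K v hv
      refine ⟨_, a⁻¹, h, ?_⟩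
      rw [← ha]
      simp [Units.smul_def]
    · rintro ⟨p, a, hp, rfl⟩
      have hne := smul_ne_zero a.ne_zero p.rep_nonzero
      exact ⟨hne, (mk_mem_iff_mem_vectors hne).2
        ((smul_mem_vectors_iff a.ne_zero).2 (rep_mem_vectors_iff.2 hp))⟩
  have h3 : Set.InjOn (fun x : ℙ K V × Kˣ ↦ (x.2 : K) • x.1.rep) (S ×ˢ Set.univ) := by
    rintro ⟨p, a⟩ - ⟨p', a'⟩ - h
    simp only at h
    have hp : p = p' := by
      rw [← mk_rep p, ← mk_rep p', mk_eq_mk_iff]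
      refine ⟨a⁻¹ * a', ?_⟩
      rw [mul_smul, Units.smul_def a', ← h]
      simp [Units.smul_def]
    subst hp
    simpa [Units.ext_iff] using smul_left_injective K p.rep_nonzero h
  rw [h1, Set.ncard_insert_of_notMem (by simp), h2, h3.ncard_image, Set.ncard_prod,
    Set.ncard_univ, Nat.card_units]

theorem ncard_eq_of_ncard_vectors_eq [Finite K] [Finite V] {W : Type*} [AddCommGroup W]
    [Module K W] [Finite W] {S : Set (ℙ K V)} {S' : Set (ℙ K W)}
    (h : (vectors S).ncard = (vectors S').ncard) : S.ncard = S'.ncard := by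
  rw [ncard_vectors, ncard_vectors] at h
  have := Finite.one_lt_card (α := K)
  exact Nat.eq_of_mul_eq_mul_right (by omega) (Nat.add_right_cancel h)

end Vectors

/-! ### Fourier inversion and invariance under translation -/

section Invariance

variable {K V : Type*} [Field K] [Fintype K] [AddCommGroup V] [Module K V] [Fintype V]
  {ψ : AddChar K ℂ}

open scoped Classical in
-- Sum over all multiples `c • φ`: scale invariance makes the terms with `c ≠ 0` equal, and `c = 0`
-- gives the total sum. Section sizes thus determine Fourier coefficients, and conversely.
theorem sub_one_mul_sum_addChar (hψ : ψ ≠ 1) {f : V → ℂ} (hf : ∀ c : K, c ≠ 0 → ∀ v, f (c • v) = f v)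
    (φ : Dual K V) :
    ((Fintype.card K : ℂ) - 1) * ∑ v, f v * ψ (φ v) =
      Fintype.card K * ∑ v with φ v = 0, f v - ∑ v, f v := by
  have h1 : ∀ c : K, c ≠ 0 → ∑ v, f v * ψ (c * φ v) = ∑ v, f v * ψ (φ v) := fun c hc ↦ by
    rw [← Equiv.sum_comp (LinearEquiv.smulOfNeZero K V c hc).toEquiv fun v ↦ f v * ψ (φ v)]
    refine Finset.sum_congr rfl fun v _ ↦ ?_
    simp [hf c hc]
  have h2 : ∑ c : K, ∑ v, f v * ψ (c * φ v) = Fintype.card K * ∑ v with φ v = 0, f v := by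
    rw [Finset.sum_comm, Finset.mul_sum, Finset.sum_filter]
    refine Finset.sum_congr rfl fun v _ ↦ ?_
    rw [← Finset.mul_sum]
    split_ifs with h
    · simp [h, mul_comm]
    · rw [sum_addChar_mul hψ h, mul_zero]
  rw [← h2, ← Finset.add_sum_erase _ _ (Finset.mem_univ (0 : K)),
    Finset.sum_congr rfl fun c hc ↦ h1 c (Finset.ne_of_mem_erase hc)]
  simp [Finset.card_erase_of_mem, Nat.cast_sub Fintype.card_pos]

open scoped Classical in
-- Frequencies with `φ e = 0` cancel between `x` and `x + e`. At all others `f` has the same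
-- coefficient as `D` times the indicator of zero.
theorem sub_apply_add_eq (hψ : ψ ≠ 1) [FiniteDimensional K V] {f : V → ℂ} {e : V} {D : ℂ}
    (h : ∀ φ : Dual K V, φ e ≠ 0 → ∑ v, f v * ψ (φ v) = D) (x : V) :
    f x - f (x + e) = D * ((if x = 0 then 1 else 0) - (if x + e = 0 then 1 else 0)) := by
  have : Finite (Dual K V) := Module.finite_of_finite K
  have : Fintype (Dual K V) := Fintype.ofFinite _
  have hN : (Fintype.card (Dual K V) : ℂ) ≠ 0 := by simp
  have inv : ∀ x, ∑ φ : Dual K V, (∑ v, f v * ψ (φ v)) * ψ (-φ x) =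
      Fintype.card (Dual K V) * f x := fun x ↦ by
    have : ∀ v, ∑ φ : Dual K V, f v * ψ (φ v) * ψ (-φ x) =
        if v = x then (Fintype.card (Dual K V) : ℂ) * f x else 0 := fun v ↦ by
      have h1 := sum_dual_addChar hψ (v - x)
      simp only [sub_eq_zero] at h1
      calc _ = f v * ∑ φ : Dual K V, ψ (φ (v - x)) := by
            rw [Finset.mul_sum]
            refine Finset.sum_congr rfl fun φ _ ↦ ?_
            rw [mul_assoc, ← AddChar.map_add_eq_mul, map_sub, sub_eq_add_neg]
        _ = _ := by
            rw [h1]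
            split_ifs with hv
            · rw [hv, mul_comm]
            · rw [mul_zero]
    simp_rw [Finset.sum_mul]
    rw [Finset.sum_comm, Finset.sum_congr rfl fun v _ ↦ this v]
    simp
  have delta : ∀ x, ∑ φ : Dual K V, D * ψ (-φ x) =
      Fintype.card (Dual K V) * (D * if x = 0 then 1 else 0) := fun x ↦ by
    have h1 := sum_dual_addChar hψ (-x)
    simp only [map_neg, neg_eq_zero] at h1
    rw [← Finset.mul_sum, h1]
    split_ifs <;> simp [mul_comm]
  have key : ∑ φ : Dual K V, (∑ v, f v * ψ (φ v)) * (ψ (-φ x) - ψ (-φ (x + e))) =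
      ∑ φ : Dual K V, D * (ψ (-φ x) - ψ (-φ (x + e))) := by
    refine Finset.sum_congr rfl fun φ _ ↦ ?_
    by_cases hφ : φ e = 0
    · simp [hφ]
    · rw [h φ hφ]
  simp only [mul_sub, Finset.sum_sub_distrib, inv, delta] at key
  rw [← mul_sub, ← mul_sub] at key
  rw [mul_left_cancel₀ hN key, mul_sub]

open scoped Classical in
/-- Two scale invariant sets of vectors of the same size, such that the sizes of their sections
with the hyperplanes not through `e` differ by a constant, have equally large such sections, and
the difference of their indicator functions is invariant under translation by `e`. -/
theorem eq_zero_and_indicator_translate [FiniteDimensional K V] {Z Z' : Set V}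
    (h0 : (0 : V) ∈ Z) (h0' : (0 : V) ∈ Z')
    (hZ : ∀ c : K, c ≠ 0 → ∀ v, c • v ∈ Z ↔ v ∈ Z)
    (hZ' : ∀ c : K, c ≠ 0 → ∀ v, c • v ∈ Z' ↔ v ∈ Z')
    (hcard : Z'.ncard = Z.ncard) {e : V} (he : e ≠ 0) {d : ℤ}
    (hd : ∀ φ : Dual K V, φ e ≠ 0 →
      ((Z' ∩ LinearMap.ker φ).ncard : ℤ) - (Z ∩ LinearMap.ker φ).ncard = d) :
    d = 0 ∧ ∀ x, (if x ∈ Z' then 1 else 0 : ℂ) - (if x ∈ Z then 1 else 0) =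
      (if x + e ∈ Z' then 1 else 0) - (if x + e ∈ Z then 1 else 0) := by
  obtain ⟨ψ, hψ⟩ := exists_addChar_ne_one K
  set f : V → ℂ := fun x ↦ (if x ∈ Z' then 1 else 0 : ℂ) - (if x ∈ Z then 1 else 0) with hf
  have hcount : ∀ Y : Set V, ∀ p : V → Prop,
      ∑ v with p v, (if v ∈ Y then 1 else 0 : ℂ) = (Y ∩ {v | p v}).ncard := fun Y p ↦ by
    rw [Finset.sum_ite, Finset.sum_const_zero, add_zero, Finset.sum_const, nsmul_one,
      Set.ncard_eq_toFinset_card']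
    congr 2
    ext v
    simp [and_comm]
  have hfs : ∀ c : K, c ≠ 0 → ∀ v, f (c • v) = f v := fun c hc v ↦ by
    simp only [hf, hZ c hc, hZ' c hc]
  have hsum : ∑ v, f v = 0 := by
    have h1 := hcount Z fun _ ↦ True
    have h2 := hcount Z' fun _ ↦ True
    simp only [Finset.filter_true, Set.ofPred_true, Set.inter_univ] at h1 h2
    rw [hf, Finset.sum_sub_distrib, h1, h2, hcard, sub_self]
  have hq : ((Fintype.card K : ℂ) - 1) ≠ 0 := by
    have := Fintype.one_lt_card (α := K)
    rw [sub_ne_zero]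
    exact_mod_cast this.ne'
  have hF : ∀ φ : Dual K V, φ e ≠ 0 →
      ∑ v, f v * ψ (φ v) = Fintype.card K * d / ((Fintype.card K : ℂ) - 1) := fun φ hφ ↦ by
    rw [eq_div_iff hq, mul_comm, sub_one_mul_sum_addChar hψ hfs, hsum, sub_zero, hf,
      Finset.sum_sub_distrib, hcount, hcount, ← hd φ hφ]
    push_cast
    rfl
  have key := sub_apply_add_eq hψ hF
  have k0 := key 0
  have hf0 : f 0 = 0 := by simp [hf, h0, h0']
  simp only [zero_add, if_true, he, if_false, sub_zero, mul_one, hf0, zero_sub] at k0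
  have hd0 : d = 0 := by
    rw [eq_div_iff hq] at k0
    have hq1 := Fintype.one_lt_card (α := K)
    -- `f e` is -1, 0 or 1, and `k0` reads `-f e * (q - 1) = q * d`; so q divides `f e`, which must
    -- be 0.
    have : ∃ ε : ℤ, f e = ε ∧ |ε| ≤ 1 := by
      by_cases h1 : e ∈ Z <;> by_cases h2 : e ∈ Z'
      · exact ⟨0, by simp [hf, h1, h2], by simp⟩
      · exact ⟨-1, by simp [hf, h1, h2], by simp⟩
      · exact ⟨1, by simp [hf, h1, h2], by simp⟩
      · exact ⟨0, by simp [hf, h1, h2], by simp⟩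
    obtain ⟨ε, hε, hε1⟩ := this
    rw [hε] at k0
    have k1 : -ε * ((Fintype.card K : ℤ) - 1) = Fintype.card K * d := by exact_mod_cast k0
    have hdvd : (Fintype.card K : ℤ) ∣ ε := ⟨d + ε, by linarith⟩
    have hε0 : ε = 0 := Int.eq_zero_of_abs_lt_dvd hdvd (by omega)
    rw [hε0, neg_zero, zero_mul] at k1
    rcases mul_eq_zero.1 k1.symm with h | h
    · omega
    · exact h
  refine ⟨hd0, fun x ↦ ?_⟩
  have := key x
  rw [hd0] at this
  simp only [Int.cast_zero, mul_zero, zero_div, zero_mul] at this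
  exact sub_eq_zero.1 this

end Invariance

end QuasiPolar


namespace QuasiPolar

/-! ### Cones in terms of vectors -/

section Cone

variable {K V : Type*} [Field K] [AddCommGroup V] [Module K V]

theorem mem_vectors_cone_iff {P : ℙ K V} {W : Submodule K V} {B : Set (ℙ K W)} {v : V} :
    v ∈ vectors (cone P W B) ↔ ∃ w ∈ vectors B, ∃ c : K, v = w + c • P.rep := by
  rcases eq_or_ne v 0 with rfl | hv
  · exact ⟨fun _ ↦ ⟨0, zero_mem_vectors _, 0, by simp⟩, fun _ ↦ zero_mem_vectors _⟩
  rw [← mk_mem_iff_mem_vectors hv, cone]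
  have hmap : ∀ (w : W) (hw : w ≠ 0),
      (Projectivization.map W.subtype W.injective_subtype (Projectivization.mk K w hw)).submodule =
        K ∙ (w : V) := fun w hw ↦ by
    rw [map_mk, submodule_mk]
    rfl
  constructor
  · rintro (h | ⟨b, hb, h⟩)
    · obtain ⟨a, ha⟩ := exists_smul_eq_mk_rep K v hv
      refine ⟨0, zero_mem_vectors _, ((a⁻¹ : Kˣ) : K), ?_⟩
      rw [Set.mem_singleton_iff] at h
      rw [← h, ← ha]
      simp [Units.smul_def]
    · induction b using Projectivization.ind with | h w hw =>
      rw [hmap, submodule_mk, P.submodule_eq, Submodule.span_singleton_le_iff_mem,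
        Submodule.mem_sup] at h
      obtain ⟨x, hx, y, hy, rfl⟩ := h
      obtain ⟨c, rfl⟩ := Submodule.mem_span_singleton.1 hx
      obtain ⟨t, rfl⟩ := Submodule.mem_span_singleton.1 hy
      refine ⟨t • w, ?_, c, by simp [add_comm]⟩
      rcases eq_or_ne t 0 with rfl | ht
      · simp [zero_mem_vectors]
      · exact (smul_mem_vectors_iff ht).2 ((mk_mem_iff_mem_vectors hw).1 hb)
  · rintro ⟨w, hw, c, rfl⟩
    rcases eq_or_ne w 0 with rfl | hw0
    · left
      rw [Set.mem_singleton_iff]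
      conv_rhs => rw [← mk_rep P]
      exact (mk_eq_mk_iff' K _ _ _ _).2 ⟨c, by simp⟩
    · right
      refine ⟨_, (mk_mem_iff_mem_vectors hw0).2 hw, ?_⟩
      rw [hmap, submodule_mk, P.submodule_eq, Submodule.span_singleton_le_iff_mem]
      exact add_mem (Submodule.mem_sup_right (Submodule.mem_span_singleton_self _))
        (Submodule.mem_sup_left (Submodule.smul_mem _ _ (Submodule.mem_span_singleton_self _)))

theorem eq_and_eq_of_add_smul_rep_eq {π W : Submodule K V} {P : ℙ K V} (hW : IsBaseSpace π P W)
    {w w' : W} {c c' : K} (h : (w : V) + c • P.rep = w' + c' • P.rep) : w = w' ∧ c = c' := by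
  have h1 : ((w - w' : W) : V) = (c' - c) • P.rep := by
    rw [Submodule.coe_sub, sub_smul, sub_eq_sub_iff_add_eq_add, h, add_comm]
  have h2 : (w : V) - w' = 0 := by
    refine Submodule.disjoint_def.1 hW.1 _ (w - w').2 ?_
    rw [← Submodule.coe_sub, h1, P.submodule_eq]
    exact Submodule.smul_mem _ _ (Submodule.mem_span_singleton_self _)
  rw [Submodule.coe_sub, h2] at h1
  refine ⟨Subtype.ext (sub_eq_zero.1 h2), ?_⟩
  have := (smul_eq_zero.1 h1.symm).resolve_right P.rep_nonzero
  exact (sub_eq_zero.1 this).symm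

theorem exists_add_smul_rep {π W : Submodule K V} {P : ℙ K V} (hW : IsBaseSpace π P W) {v : V} :
    v ∈ π ↔ ∃ (w : W) (c : K), v = w + c • P.rep := by
  rw [← hW.2, Submodule.mem_sup, P.submodule_eq]
  constructor
  · rintro ⟨w, hw, y, hy, rfl⟩
    obtain ⟨c, rfl⟩ := Submodule.mem_span_singleton.1 hy
    exact ⟨⟨w, hw⟩, c, rfl⟩
  · rintro ⟨w, c, rfl⟩
    exact ⟨w, w.2, _, Submodule.mem_span_singleton.2 ⟨c, rfl⟩, rfl⟩

theorem ncard_add_smul_rep {π W : Submodule K V} {P : ℙ K V} (hW : IsBaseSpace π P W) (X : Set W) :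
    {v : V | ∃ w ∈ X, ∃ c : K, v = w + c • P.rep}.ncard = X.ncard * Nat.card K := by
  have h1 : {v : V | ∃ w ∈ X, ∃ c : K, v = w + c • P.rep} =
      (fun x : W × K ↦ (x.1 : V) + x.2 • P.rep) '' (X ×ˢ Set.univ) := by
    ext v
    constructor
    · rintro ⟨w, hw, c, rfl⟩
      exact ⟨(w, c), ⟨hw, trivial⟩, rfl⟩
    · rintro ⟨⟨w, c⟩, ⟨hw, -⟩, rfl⟩
      exact ⟨w, hw, c, rfl⟩
  have h2 : Set.InjOn (fun x : W × K ↦ (x.1 : V) + x.2 • P.rep) (X ×ˢ Set.univ) := by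
    rintro ⟨w, c⟩ - ⟨w', c'⟩ - h
    exact Prod.ext_iff.2 (eq_and_eq_of_add_smul_rep_eq hW h)
  rw [h1, h2.ncard_image, Set.ncard_prod, Set.ncard_univ]

theorem ncard_inter_ker {π W : Submodule K V} {P : ℙ K V} (hW : IsBaseSpace π P W)
    {S : Set (ℙ K V)} {B : Set (ℙ K W)} (hS : S ∩ π.projectivization = cone P W B)
    {φ : Dual K V} (hφ : φ P.rep = 0) :
    (vectors S ∩ LinearMap.ker φ ∩ π).ncard =
      (vectors B ∩ LinearMap.ker (φ ∘ₗ W.subtype)).ncard * Nat.card K := by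
  rw [← ncard_add_smul_rep hW, Set.inter_right_comm, ← vectors_inter_projectivization, hS]
  congr 1
  ext v
  rw [Set.mem_inter_iff, mem_vectors_cone_iff]
  constructor
  · rintro ⟨⟨w, hw, c, rfl⟩, h⟩
    exact ⟨w, ⟨hw, by simpa [hφ] using h⟩, c, rfl⟩
  · rintro ⟨w, ⟨hw, h⟩, c, rfl⟩
    exact ⟨⟨w, hw, c, rfl⟩, by simpa [hφ] using h⟩

theorem mem_vectors_preimage_map {W : Submodule K V} {S : Set (ℙ K V)} {w : W} :
    w ∈ vectors (Projectivization.map W.subtype W.injective_subtype ⁻¹' S) ↔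
      (w : V) ∈ vectors S := by
  rcases eq_or_ne w 0 with rfl | hw
  · simp [zero_mem_vectors]
  · rw [← mk_mem_iff_mem_vectors hw, ← mk_mem_iff_mem_vectors (Subtype.coe_ne_coe.2 hw)]
    rfl

end Cone

/-! ### Hyperplanes as kernels of functionals -/

section Functionals

variable {K V : Type*} [Field K] [AddCommGroup V] [Module K V]

theorem exists_dual_ker_eq {H : Submodule K V} (hH : IsCoatom H) :
    ∃ φ : Dual K V, φ ≠ 0 ∧ LinearMap.ker φ = H := by
  obtain ⟨φ, hφ, h⟩ := Submodule.exists_le_ker_of_lt_top H hH.lt_top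
  exact ⟨φ, hφ, ((hH.le_iff.1 h).resolve_left fun h' ↦
    hφ (LinearMap.ker_eq_top.1 h'))⟩

theorem isCoatom_ker {φ : Dual K V} (hφ : φ ≠ 0) : IsCoatom (LinearMap.ker φ) :=
  LinearMap.isCoatom_ker_of_surjective (LinearMap.surjective hφ)

theorem exists_smul_eq_of_forall_apply_eq_zero {φ φ₀ : Dual K V} (h : ∀ v, φ₀ v = 0 → φ v = 0) :
    ∃ c : K, φ = c • φ₀ := by
  by_cases h0 : ∃ u, φ₀ u ≠ 0
  · obtain ⟨u, hu⟩ := h0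
    refine ⟨φ u / φ₀ u, LinearMap.ext fun v ↦ ?_⟩
    have := h (v - (φ₀ v / φ₀ u) • u) (by simp [hu])
    rw [map_sub, map_smul, smul_eq_mul, sub_eq_zero] at this
    rw [this, LinearMap.smul_apply, smul_eq_mul]
    field_simp
  · push Not at h0
    exact ⟨0, LinearMap.ext fun v ↦ by simpa using h v (h0 v)⟩

theorem exists_dual_extend {W : Submodule K V} {P : ℙ K V} (h : Disjoint W P.submodule)
    (φ' : Dual K W) : ∃ φ : Dual K V, φ ∘ₗ W.subtype = φ' ∧ φ P.rep = 0 := by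
  obtain ⟨C, hWC, hC⟩ := h.exists_isCompl
  obtain ⟨g, hg⟩ := LinearMap.exists_extend φ'
  refine ⟨g ∘ₗ C.subtype ∘ₗ C.projectionOnto P.submodule hC, ?_, ?_⟩
  · ext w
    have := Submodule.projectionOnto_apply_left hC ⟨w, hWC w.2⟩
    simp only [LinearMap.comp_apply, Submodule.subtype_apply] at this ⊢
    rw [this, ← hg]
    rfl
  · have hP : P.rep ∈ P.submodule := by
      rw [P.submodule_eq]
      exact Submodule.mem_span_singleton_self _
    simp [(Submodule.projectionOnto_apply_eq_zero_iff hC).2 hP]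

end Functionals

end QuasiPolar


/-! ### Switching in an abstract polar space -/

namespace QuasiPolar

/-- The set `Z` is the zero set of a quadratic or Hermitian form `h` with associated
non-degenerate reflexive form `β`, such that the size of the section of `Z` with the hyperplane
orthogonal to `y` is determined by the value `h y`. -/
structure IsPolarModel {K V k : Type*} [Field K] [AddCommGroup V] [Module K V] [Field k]
    {σ : K →+* K} (β : V →ₛₗ[σ] V →ₗ[K] K) (h : V → k) (val : k → ℂ) (Z : Set V) : Prop where
  mem_iff : ∀ v, v ∈ Z ↔ h v = 0
  eq_zero : ∀ y, (∀ x, β y x = 0) → y = 0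
  symm : ∀ x y, β x y = 0 → β y x = 0
  self : ∀ x, h x = 0 → β x x = 0
  -- Along `y + K x` with `x` singular, `h` is constant if `y` is orthogonal to `x`, and takes every
  -- value otherwise.
  tangent : ∀ x y (c : K), h x = 0 → β y x = 0 → h (y + c • x) = h y
  secant : ∀ x y a, h x = 0 → β y x ≠ 0 → ∃ c : K, h (y + c • x) = a
  ncard_section : ∀ y, y ≠ 0 → ((Z ∩ LinearMap.ker (β y)).ncard : ℂ) = val (h y)

/-- Each translate of `A` must be all of `A'`; comparing the sums of the elements determines the
translation, as the characteristic is zero. -/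
theorem eq_of_forall_add_mem {ι : Type*} {A A' : Set ℂ} (hA : A.Finite) (hA0 : A.Nonempty)
    (hA' : A'.Finite) (hcard : A'.ncard ≤ A.ncard) {d : ι → ℂ}
    (hd : ∀ i, ∀ a ∈ A, a + d i ∈ A') (i j : ι) : d i = d j := by
  classical
  lift A to Finset ℂ using hA
  lift A' to Finset ℂ using hA'
  simp only [Set.ncard_coe_finset, Finset.mem_coe] at hcard hd
  have key : ∀ i, ∑ a ∈ A', a = ∑ a ∈ A, a + A.card * d i := fun i ↦ by
    have h1 : A.image (· + d i) = A' := by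
      refine Finset.eq_of_subset_of_card_le (fun x hx ↦ ?_) ?_
      · obtain ⟨a, ha, rfl⟩ := Finset.mem_image.1 hx
        exact hd i a ha
      · rwa [Finset.card_image_of_injective _ (add_left_injective _)]
    rw [← h1, Finset.sum_image (add_left_injective _).injOn, Finset.sum_add_distrib,
      Finset.sum_const, nsmul_eq_mul]
  have hne : (A.card : ℂ) ≠ 0 := by
    rw [Nat.cast_ne_zero]
    exact (Finset.card_pos.2 hA0).ne'
  exact mul_left_cancel₀ hne (add_left_cancel ((key i).symm.trans (key j)))

namespace IsPolarModel

variable {K V k : Type*} [Field K] [Finite K] [AddCommGroup V] [Module K V]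
  [FiniteDimensional K V] [Field k] {σ : K →+* K} {β : V →ₛₗ[σ] V →ₗ[K] K} {h : V → k}
  {val : k → ℂ} {Z : Set V}

section

variable (M : IsPolarModel β h val Z)

include M

theorem exists_apply_eq (φ : Dual K V) : ∃ y, β y = φ := by
  have : Finite V := Module.finite_of_finite K
  have : Finite (Dual K V) := Module.finite_of_finite K
  have hinj : Function.Injective β := (injective_iff_map_eq_zero β).2 fun y hy ↦
    M.eq_zero y fun x ↦ by simp [hy]
  have hcard : Nat.card (Dual K V) ≤ Nat.card V := by
    rw [Module.natCard_eq_pow_finrank (K := K) (V := V),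
      Module.natCard_eq_pow_finrank (K := K) (V := Dual K V), Subspace.dual_finrank_eq]
  exact (hinj.bijective_of_nat_card_le hcard).surjective φ

omit [FiniteDimensional K V] in
theorem mem_span_of_forall {e y : V} (hy : ∀ v, β e v = 0 → β y v = 0) :
    y ∈ Submodule.span K {e} := by
  obtain ⟨c, hc⟩ := exists_smul_eq_of_forall_apply_eq_zero hy
  obtain ⟨c, rfl⟩ := (Finite.injective_iff_surjective.1 σ.injective) c
  refine Submodule.mem_span_singleton.2 ⟨c, ?_⟩
  refine (sub_eq_zero.1 (M.eq_zero (y - c • e) fun x ↦ ?_)).symm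
  rw [map_sub, hc, LinearMap.map_smulₛₗ, sub_self, LinearMap.zero_apply]

/-- The size of the part outside of a tangent hyperplane of a section with another hyperplane
through the point of tangency. -/
theorem ncard_mul_ncard_diff {e y : V} (he : h e = 0) (hye : β e y = 0)
    (hy : y ∉ Submodule.span K {e}) :
    Nat.card K * ((Z ∩ LinearMap.ker (β y)) \ LinearMap.ker (β e)).ncard =
      (Z \ LinearMap.ker (β e)).ncard := by
  classical
  have : Finite V := Module.finite_of_finite K
  have : Fintype V := Fintype.ofFinite V
  have : Fintype K := Fintype.ofFinite K
  have hsec : ∀ c : K, (Z ∩ LinearMap.ker (β y + c • β e)).ncard =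
      (Z ∩ LinearMap.ker (β y)).ncard := fun c ↦ by
    obtain ⟨c, rfl⟩ := (Finite.injective_iff_surjective.1 σ.injective) c
    have h1 : β y + σ c • β e = β (y + c • e) := by rw [map_add, LinearMap.map_smulₛₗ]
    have hy0 : y ≠ 0 := fun h ↦ hy (h ▸ zero_mem _)
    have hyc : y + c • e ≠ 0 := fun h ↦ hy <| by
      rw [eq_neg_of_add_eq_zero_left h]
      exact neg_mem (Submodule.smul_mem _ _ (Submodule.mem_span_singleton_self e))
    have h2 := M.ncard_section _ hyc
    rw [M.tangent e y c he (M.symm _ _ hye), ← M.ncard_section y hy0, ← h1] at h2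
    exact_mod_cast h2
  have hdiff : ∀ c : K, ((Z ∩ LinearMap.ker (β y + c • β e)) \ LinearMap.ker (β e)).ncard =
      ((Z ∩ LinearMap.ker (β y)) \ LinearMap.ker (β e)).ncard := fun c ↦ by
    have h1 := Set.ncard_inter_add_ncard_sdiff_eq_ncard (Z ∩ LinearMap.ker (β y + c • β e))
      (LinearMap.ker (β e)) (Set.toFinite _)
    have h2 := Set.ncard_inter_add_ncard_sdiff_eq_ncard (Z ∩ LinearMap.ker (β y))
      (LinearMap.ker (β e)) (Set.toFinite _)
    have h3 : Z ∩ LinearMap.ker (β y + c • β e) ∩ LinearMap.ker (β e) =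
        Z ∩ LinearMap.ker (β y) ∩ LinearMap.ker (β e) := by
      ext v
      simp only [Set.mem_inter_iff, SetLike.mem_coe, LinearMap.mem_ker, LinearMap.add_apply,
        LinearMap.smul_apply, and_congr_left_iff, and_congr_right_iff]
      intro hv _
      rw [hv, smul_zero, add_zero]
    rw [h3, hsec c] at h1
    omega
  -- Each vector off `ker (β e)` lies in exactly one of the hyperplanes `ker (β y + c • β e)`, and
  -- these q hyperplanes have equally large parts outside `ker (β e)`.
  have hfib := Finset.card_eq_sum_card_fiberwise (f := fun v ↦ -β y v / β e v)
    (s := (Z \ LinearMap.ker (β e)).toFinset) (t := Finset.univ) (fun _ _ ↦ Finset.mem_univ _)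
  rw [← Set.ncard_eq_toFinset_card'] at hfib
  rw [hfib, Finset.sum_congr rfl fun c _ ↦ ?_, Finset.sum_const, Finset.card_univ,
    Nat.card_eq_fintype_card, smul_eq_mul]
  rw [← hdiff c, Set.ncard_eq_toFinset_card']
  congr 1
  ext v
  simp only [Finset.mem_filter, Set.mem_toFinset, Set.mem_sdiff, Set.mem_inter_iff, SetLike.mem_coe,
    LinearMap.mem_ker, LinearMap.add_apply, LinearMap.smul_apply, smul_eq_mul]
  constructor
  · rintro ⟨⟨hv, hv'⟩, rfl⟩
    exact ⟨⟨hv, by field_simp; ring⟩, hv'⟩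
  · rintro ⟨⟨hv, hv'⟩, hv''⟩
    exact ⟨⟨hv, hv''⟩, by rw [eq_neg_of_add_eq_zero_left hv']; field_simp⟩

end

variable {S : Set (ℙ K V)}

omit [Finite K] [FiniteDimensional K V] in
-- If `v` in `π` were not orthogonal to the vertex, its translates by multiples of `P.rep` would
-- include both singular and nonsingular vectors, whereas the cone contains all of them or none.
theorem eq_ker_of_inter_eq_cone (M : IsPolarModel β h val (vectors S)) {π W : Submodule K V}
    {P : ℙ K V} {B : Set (ℙ K W)} (hπ : IsCoatom π)
    (hB : S ∩ π.projectivization = cone P W B) :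
    h P.rep = 0 ∧ π = LinearMap.ker (β P.rep) := by
  have hcone : ∀ v, v ∈ vectors S ∩ π ↔ ∃ w ∈ vectors B, ∃ c : K, v = w + c • P.rep := fun v ↦ by
    rw [← vectors_inter_projectivization, hB, mem_vectors_cone_iff]
  have hP : P.rep ∈ vectors S ∩ π := (hcone _).2 ⟨0, zero_mem_vectors _, 1, by simp⟩
  have he : h P.rep = 0 := (M.mem_iff _).1 hP.1
  refine ⟨he, ?_⟩
  have hle : π ≤ LinearMap.ker (β P.rep) := by
    intro v hv
    by_contra hne
    have hne' : β v P.rep ≠ 0 := fun h0 ↦ hne (M.symm _ _ h0)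
    obtain ⟨c, hc⟩ := M.secant _ _ 0 he hne'
    obtain ⟨c', hc'⟩ := M.secant _ _ 1 he hne'
    obtain ⟨w, hw, t, ht⟩ := (hcone (v + c • P.rep)).1
      ⟨(M.mem_iff _).2 hc, add_mem hv (Submodule.smul_mem _ _ hP.2)⟩
    have : v + c' • P.rep ∈ vectors S ∩ π := (hcone _).2 ⟨w, hw, t + c' - c, by
      rw [sub_smul, add_smul, ← add_sub_assoc, ← add_assoc, ← ht]
      abel⟩
    rw [(M.mem_iff _).1 this.1] at hc'
    exact zero_ne_one hc'
  refine ((hπ.le_iff.1 hle).resolve_left fun htop ↦ ?_).symm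
  refine P.rep_nonzero (M.eq_zero _ fun x ↦ ?_)
  have : x ∈ LinearMap.ker (β P.rep) := htop ▸ Submodule.mem_top
  exact this

/-- A set of points that agrees outside of a singular hyperplane with a polar space, has the same
size, and does not have more hyperplane section sizes, meets the singular hyperplane in a cone
whose base has section sizes that occur for the base of the original cone. -/
theorem exists_cone (M : IsPolarModel β h val (vectors S)) [Finite k] {π W : Submodule K V}
    {P : ℙ K V} {B : Set (ℙ K W)} (hπ : IsCoatom π) (hW : IsBaseSpace π P W)
    (hB : S ∩ π.projectivization = cone P W B) {S' : Set (ℙ K V)} (hcard : S'.ncard = S.ncard)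
    (hS' : S' \ π.projectivization = S \ π.projectivization)
    {A' : Set ℂ} (hA'fin : A'.Finite) (hA'card : A'.ncard ≤ (Set.range val).ncard)
    (hA' : ∀ φ : Dual K V, φ ≠ 0 → ((vectors S' ∩ LinearMap.ker φ).ncard : ℂ) ∈ A') :
    ∃ B' : Set (ℙ K W), S' ∩ π.projectivization = cone P W B' ∧ B'.ncard = B.ncard ∧
      ∀ H : Submodule K W, IsCoatom H → ∃ H₀ : Submodule K W, IsCoatom H₀ ∧
        (B' ∩ H.projectivization).ncard = (B ∩ H₀.projectivization).ncard := by
  classical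
  have : Finite V := Module.finite_of_finite K
  have : Fintype V := Fintype.ofFinite V
  have : Fintype K := Fintype.ofFinite K
  obtain ⟨he, hπe⟩ := M.eq_ker_of_inter_eq_cone hπ hB
  set e := P.rep with he_def
  have heπ : e ∈ π := (exists_add_smul_rep hW).2 ⟨0, 1, by simp [e]⟩
  have hout : vectors S' \ π = vectors S \ π := by
    ext v
    rcases eq_or_ne v 0 with rfl | hv
    · simp
    · have := Set.ext_iff.1 hS' (Projectivization.mk K v hv)
      simp only [Set.mem_sdiff, ← mk_mem_iff_mem_vectors hv] at this ⊢
      exact this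
  have hvcard : (vectors S').ncard = (vectors S).ncard := by
    rw [ncard_vectors, ncard_vectors, hcard]
  -- the defects of the sections
  have hsplit : ∀ (Y : Set V) (φ : Dual K V), (Y ∩ LinearMap.ker φ).ncard =
      (Y ∩ LinearMap.ker φ ∩ π).ncard + ((Y \ π) ∩ LinearMap.ker φ).ncard := fun Y φ ↦ by
    rw [← Set.ncard_inter_add_ncard_sdiff_eq_ncard (Y ∩ LinearMap.ker φ) π (Set.toFinite _)]
    congr 2
    ext v
    simp only [Set.mem_sdiff, Set.mem_inter_iff]
    tauto
  set d : Dual K V → ℤ := fun φ ↦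
    ((vectors S' ∩ LinearMap.ker φ).ncard : ℤ) - (vectors S ∩ LinearMap.ker φ).ncard with hd
  have hd' : ∀ φ, d φ = ((vectors S' ∩ LinearMap.ker φ ∩ π).ncard : ℤ) -
      (vectors S ∩ LinearMap.ker φ ∩ π).ncard := fun φ ↦ by
    rw [hd]
    simp only
    rw [hsplit (vectors S') φ, hsplit (vectors S) φ, hout]
    push_cast
    ring
  have hdadd : ∀ y c, d (β (y + c • e)) = d (β y) := fun y c ↦ by
    have h3 : ∀ Y : Set V, Y ∩ LinearMap.ker (β (y + c • e)) ∩ π =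
        Y ∩ LinearMap.ker (β y) ∩ π := fun Y ↦ by
      ext v
      simp only [Set.mem_inter_iff, SetLike.mem_coe, LinearMap.mem_ker, and_congr_left_iff,
        and_congr_right_iff]
      intro hv _
      rw [hπe, LinearMap.mem_ker] at hv
      rw [map_add, LinearMap.add_apply, LinearMap.map_smulₛₗ, LinearMap.smul_apply, hv, smul_zero,
        add_zero]
    rw [hd', hd', h3, h3]
  -- The defect `d` is constant along `y + c • e` by `hdadd`, while `secant` realises any prescribed
  -- value `α` there.
  have hshift : ∀ φ : {φ : Dual K V // φ e ≠ 0}, ∀ a ∈ Set.range val, a + (d φ.1 : ℂ) ∈ A' := by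
    rintro ⟨φ, hφ⟩ - ⟨α, rfl⟩
    obtain ⟨y, rfl⟩ := M.exists_apply_eq φ
    obtain ⟨c, hc⟩ := M.secant e y α he hφ
    have h1 : β (y + c • e) e = β y e := by
      rw [map_add, LinearMap.add_apply, LinearMap.map_smulₛₗ, LinearMap.smul_apply, M.self e he,
        smul_zero, add_zero]
    have h2 : β (y + c • e) ≠ 0 := fun h0 ↦ hφ (by rw [← h1, h0, LinearMap.zero_apply])
    have h3 : y + c • e ≠ 0 := fun h0 ↦ h2 (by rw [h0, map_zero])
    have h4 := hA' _ h2
    rw [← hc, ← M.ncard_section _ h3, ← hdadd y c]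
    convert h4 using 1
    simp [hd]
  obtain ⟨φ₁, hφ₁⟩ : ∃ φ : Dual K V, φ e ≠ 0 := by
    by_contra! hall
    exact P.rep_nonzero ((Module.forall_dual_apply_eq_zero_iff K e).1 hall)
  have hconst : ∀ φ : Dual K V, φ e ≠ 0 → d φ = d φ₁ := fun φ hφ ↦ by
    have := eq_of_forall_add_mem (Set.finite_range val) (Set.range_nonempty val) hA'fin hA'card
      hshift ⟨φ, hφ⟩ ⟨φ₁, hφ₁⟩
    exact_mod_cast this
  obtain ⟨hd0, htrans⟩ := eq_zero_and_indicator_translate (zero_mem_vectors S)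
    (zero_mem_vectors S') (fun c hc v ↦ smul_mem_vectors_iff hc)
    (fun c hc v ↦ smul_mem_vectors_iff hc) hvcard P.rep_nonzero hconst
  have hA'eq : Set.range val = A' := by
    refine Set.eq_of_subset_of_ncard_le (fun a ha ↦ ?_) hA'card hA'fin
    simpa [hd0] using hshift ⟨φ₁, hφ₁⟩ a ha
  -- the intersection with the hyperplane is a cone
  have hcone : ∀ v, v ∈ vectors S ∩ π ↔ ∃ w ∈ vectors B, ∃ c : K, v = w + c • e := fun v ↦ by
    rw [← vectors_inter_projectivization, hB, mem_vectors_cone_iff]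
  -- Within `π` the original cone is itself invariant under translation by `e`, so invariance of the
  -- difference passes to `S'`.
  have hadd : ∀ x ∈ π, x ∈ vectors S' ↔ x + e ∈ vectors S' := fun x hx ↦ by
    have h1 : x ∈ vectors S ↔ x + e ∈ vectors S := by
      constructor
      · intro h
        obtain ⟨w, hw, c, rfl⟩ := (hcone x).1 ⟨h, hx⟩
        exact ((hcone _).2 ⟨w, hw, c + 1, by rw [add_smul, one_smul, add_assoc]⟩).1
      · intro h
        obtain ⟨w, hw, c, h⟩ := (hcone (x + e)).1 ⟨h, add_mem hx heπ⟩
        refine ((hcone _).2 ⟨w, hw, c - 1, ?_⟩).1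
        rw [sub_smul, one_smul, ← add_sub_assoc, ← h, add_sub_cancel_right]
    have h2 := htrans x
    rw [← he_def] at h2
    have h5 : (if x ∈ vectors S then 1 else 0 : ℂ) = if x + e ∈ vectors S then 1 else 0 :=
      if_congr h1 rfl rfl
    rw [h5, sub_left_inj] at h2
    by_cases h3 : x ∈ vectors S' <;> by_cases h4 : x + e ∈ vectors S' <;> simp [h3, h4] at h2 ⊢
  have hadd' : ∀ x ∈ π, ∀ c : K, x + c • e ∈ vectors S' ↔ x ∈ vectors S' := fun x hx c ↦ by
    rcases eq_or_ne c 0 with rfl | hc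
    · simp
    · have h1 : x + c • e = c • (c⁻¹ • x + e) := by rw [smul_add, smul_inv_smul₀ hc]
      rw [h1, smul_mem_vectors_iff hc, ← hadd _ (Submodule.smul_mem _ _ hx),
        smul_mem_vectors_iff (inv_ne_zero hc)]
  have hWπ : ∀ w : W, (w : V) ∈ π := fun w ↦ (exists_add_smul_rep hW).2 ⟨w, 0, by simp⟩
  set B' : Set (ℙ K W) := Projectivization.map W.subtype W.injective_subtype ⁻¹' S'
  have hB' : S' ∩ π.projectivization = cone P W B' := by
    apply vectors_injective
    rw [vectors_inter_projectivization]
    ext v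
    rw [mem_vectors_cone_iff, Set.mem_inter_iff, SetLike.mem_coe, exists_add_smul_rep hW]
    constructor
    · rintro ⟨h1, w, c, rfl⟩
      exact ⟨w, mem_vectors_preimage_map.2 ((hadd' _ (hWπ w) c).1 h1), c, rfl⟩
    · rintro ⟨w, hw, c, rfl⟩
      exact ⟨(hadd' _ (hWπ w) c).2 (mem_vectors_preimage_map.1 hw), w, c, rfl⟩
  have hq : 0 < Nat.card K := Nat.card_pos
  have hB'card : B'.ncard = B.ncard := by
    apply ncard_eq_of_ncard_vectors_eq (K := K)
    have h1 := ncard_inter_ker hW hB (φ := 0) rfl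
    have h2 := ncard_inter_ker hW hB' (φ := 0) rfl
    have h3 := Set.ncard_inter_add_ncard_sdiff_eq_ncard (vectors S) π (Set.toFinite _)
    have h4 := Set.ncard_inter_add_ncard_sdiff_eq_ncard (vectors S') π (Set.toFinite _)
    simp only [LinearMap.zero_comp, LinearMap.ker_zero, Submodule.top_coe, Set.inter_univ] at h1 h2
    rw [hout] at h4
    refine Nat.eq_of_mul_eq_mul_right hq ?_
    omega
  refine ⟨B', hB', hB'card, fun H hH ↦ ?_⟩
  -- A point of `B` is needed below, as a singular direction in `π` other than the vertex.
  rcases B.eq_empty_or_nonempty with hBe | ⟨b, hb⟩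
  · rw [hBe, Set.ncard_empty, Set.ncard_eq_zero] at hB'card
    exact ⟨H, hH, by rw [hBe, hB'card]⟩
  -- a hyperplane through the vertex with the right section
  obtain ⟨φ', hφ'0, hφ'⟩ := exists_dual_ker_eq hH
  obtain ⟨φ, hφ, hφe⟩ := exists_dual_extend hW.1 φ'
  have hφ0 : φ ≠ 0 := fun h0 ↦ hφ'0 (by rw [← hφ, h0, LinearMap.zero_comp])
  obtain ⟨y, rfl⟩ := M.exists_apply_eq φ
  have hspan : ∀ y : V, y ∈ Submodule.span K {e} → ∀ x ∈ π, β y x = 0 := fun y hy x hx ↦ by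
    obtain ⟨c, rfl⟩ := Submodule.mem_span_singleton.1 hy
    rw [hπe, LinearMap.mem_ker] at hx
    rw [LinearMap.map_smulₛₗ, LinearMap.smul_apply, hx, smul_zero]
  have hy : y ∉ Submodule.span K {e} := fun hy ↦ hφ'0 <| by
    rw [← hφ]
    ext w
    exact hspan y hy w (hWπ w)
  have hyA := hA' _ hφ0
  rw [← hA'eq] at hyA
  obtain ⟨α, hα⟩ := hyA
  -- Start from a vector of `π` not orthogonal to the singular vector `b.rep`; moving along `b.rep`
  -- stays in `π` and reaches the value `α`.
  obtain ⟨z, hzπ, hz, hzα⟩ : ∃ z ∈ π, z ∉ Submodule.span K {e} ∧ h z = α := by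
    have hbS : (b.rep : V) ∈ vectors S ∩ π :=
      (hcone _).2 ⟨b.rep, rep_mem_vectors_iff.2 hb, 0, by simp⟩
    have hx : h (b.rep : V) = 0 := (M.mem_iff _).1 hbS.1
    have hxe : (b.rep : V) ∉ Submodule.span K {e} := fun hx ↦ by
      rw [← P.submodule_eq] at hx
      exact b.rep_nonzero (Subtype.ext (Submodule.disjoint_def.1 hW.1 _ b.rep.2 hx))
    obtain ⟨y, hyπ, hyx⟩ : ∃ y, β e y = 0 ∧ β (b.rep : V) y ≠ 0 := by
      by_contra! hall
      exact hxe (M.mem_span_of_forall hall)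
    obtain ⟨c, hc⟩ := M.secant _ y α hx fun h0 ↦ hyx (M.symm _ _ h0)
    refine ⟨_, ?_, fun hmem ↦ hyx (M.symm _ _ ?_), hc⟩
    · exact add_mem (by rw [hπe]; exact hyπ) (Submodule.smul_mem _ _ hbS.2)
    · have := hspan _ hmem _ hbS.2
      rwa [map_add, LinearMap.add_apply, LinearMap.map_smulₛₗ, LinearMap.smul_apply,
        M.self _ hx, smul_zero, add_zero] at this
  have hz0 : z ≠ 0 := fun h0 ↦ hz (h0 ▸ zero_mem _)
  have hez : β e z = 0 := by rwa [hπe] at hzπ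
  have hze : β z e = 0 := M.symm _ _ hez
  have hne : β z ∘ₗ W.subtype ≠ 0 := fun h0 ↦ by
    refine hz (M.mem_span_of_forall fun v hv ↦ ?_)
    have hvπ : v ∈ π := by rw [hπe]; exact hv
    obtain ⟨w, c, rfl⟩ := (exists_add_smul_rep hW).1 hvπ
    have h1 : β z w = 0 := DFunLike.congr_fun h0 w
    rw [map_add, map_smul, h1, hze, smul_zero, add_zero]
  refine ⟨_, isCoatom_ker hne, ?_⟩
  have hW' : Finite W := inferInstance
  rw [← hφ', ← hφ]
  apply ncard_eq_of_ncard_vectors_eq (K := K)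
  rw [vectors_inter_projectivization, vectors_inter_projectivization]
  refine Nat.eq_of_mul_eq_mul_right hq ?_
  rw [← ncard_inter_ker hW hB' hφe, ← ncard_inter_ker hW hB hze]
  -- The sections of `S` by `z⊥` and of `S'` by `y⊥` have equal size, and so do their parts outside
  -- `π`; hence their parts inside agree.
  have e1 := M.ncard_section z hz0
  rw [hzα, hα, Nat.cast_inj, hsplit, hsplit (vectors S')] at e1
  have e2 := M.ncard_mul_ncard_diff he hez hz
  have e3 := M.ncard_mul_ncard_diff he (M.symm _ _ hφe) hy
  rw [← e2, ← hπe] at e3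
  have e4 := Nat.eq_of_mul_eq_mul_left hq e3
  have e5 : ∀ (Y : Set V) (φ : Dual K V), (Y ∩ LinearMap.ker φ) \ π =
      (Y \ π) ∩ LinearMap.ker φ := fun Y φ ↦ by
    ext v
    simp only [Set.mem_sdiff, Set.mem_inter_iff]
    tauto
  rw [e5, e5] at e4
  rw [hout] at e1
  omega

end IsPolarModel

end QuasiPolar


namespace QuasiPolar

/-! ### Parity of the rank of alternating forms -/

section Alternating

variable {K V : Type*} [Field K] [AddCommGroup V] [Module K V] [FiniteDimensional K V]

open LinearMap.BilinForm in
-- A maximal totally isotropic subspace works: any further vector orthogonal to it could be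
-- adjoined, being isotropic itself.
theorem exists_orthogonal_eq_self {B : LinearMap.BilinForm K V} (hB : B.IsAlt) :
    ∃ U : Submodule K V, B.orthogonal U = U := by
  obtain ⟨U, hU, hmax⟩ := (wellFounded_gt (α := Submodule K V)).has_min
    {U | U ≤ B.orthogonal U} ⟨⊥, by simp⟩
  refine ⟨U, le_antisymm (fun x hx ↦ ?_) hU⟩
  by_contra hxU
  refine hmax (U ⊔ K ∙ x) ?_ (lt_of_le_of_ne le_sup_left fun h ↦ hxU ?_)
  · intro v hv
    obtain ⟨u, hu, y, hy, rfl⟩ := Submodule.mem_sup.1 hv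
    obtain ⟨c, rfl⟩ := Submodule.mem_span_singleton.1 hy
    rw [LinearMap.BilinForm.mem_orthogonal_iff]
    intro v' hv'
    obtain ⟨u', hu', y', hy', rfl⟩ := Submodule.mem_sup.1 hv'
    obtain ⟨c', rfl⟩ := Submodule.mem_span_singleton.1 hy'
    have h1 : B u' u = 0 := mem_orthogonal_iff.1 (hU hu) u' hu'
    have h2 : B u' x = 0 := mem_orthogonal_iff.1 hx u' hu'
    have h3 : B x u = 0 := hB.isRefl _ _ (mem_orthogonal_iff.1 hx u hu)
    simp [h1, h2, h3, hB x]
  · rw [h]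
    exact Submodule.mem_sup_right (Submodule.mem_span_singleton_self x)

theorem even_finrank_add_finrank_ker {B : LinearMap.BilinForm K V} (hB : B.IsAlt) :
    Even (finrank K V + finrank K (LinearMap.ker B)) := by
  obtain ⟨U, hU⟩ := exists_orthogonal_eq_self hB
  have h := LinearMap.BilinForm.finrank_add_finrank_orthogonal' (B := B) U
  have hle : LinearMap.ker B ≤ U := fun x hx ↦ by
    rw [← hU, LinearMap.BilinForm.mem_orthogonal_iff]
    intro u _
    refine hB.isRefl _ _ ?_
    rw [LinearMap.mem_ker.1 hx, LinearMap.zero_apply]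
  rw [hU, inf_eq_right.2 hle] at h
  exact ⟨_, h.symm⟩

end Alternating

/-! ### Non-degeneracy of the polar form -/

section Polar

variable {K V : Type*} [Field K] [Finite K] [AddCommGroup V] [Module K V]
  [FiniteDimensional K V]

omit [Finite K] [FiniteDimensional K V] in
theorem polar_nondegenerate_of_odd {Q : QuadraticForm K V} (hQ : Q.radical = ⊥)
    (h2 : ringChar K ≠ 2) (y : V) (hy : ∀ x, QuadraticMap.polar Q y x = 0) : y = 0 := by
  have := invertibleOfNonzero (Ring.two_ne_zero h2)
  rw [QuadraticMap.radical_eq_ker_polarBilin] at hQ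
  rw [← Submodule.mem_bot K, ← hQ, LinearMap.mem_ker]
  ext x
  simpa using hy x

/-- In characteristic 2, every scalar is a square and `Q` is additive on the kernel of its polar
form, so a trivial radical leaves that kernel dimension at most 1. The polar form is alternating, so
in even dimension the kernel has even dimension and vanishes. -/
theorem polar_nondegenerate_of_even {Q : QuadraticForm K V} (hQ : Q.radical = ⊥)
    (hV : Even (finrank K V)) (y : V) (hy : ∀ x, QuadraticMap.polar Q y x = 0) : y = 0 := by
  by_cases h2 : ringChar K = 2
  swap
  · exact polar_nondegenerate_of_odd hQ h2 y hy
  have : CharP K 2 := ringChar.of_eq h2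
  have h0 : ∀ v, QuadraticMap.polar Q v v = 0 := fun v ↦ by
    rw [QuadraticMap.polar_self, two_nsmul, CharTwo.add_self_eq_zero]
  have hker : ∀ x, x ∈ LinearMap.ker Q.polarBilin ↔ ∀ v, QuadraticMap.polar Q x v = 0 := fun x ↦ by
    simp [LinearMap.ext_iff]
  by_contra hy0
  have hyQ : Q y ≠ 0 := fun h ↦ hy0 <| by
    rw [← Submodule.mem_bot K, ← hQ]
    exact ⟨h, (hker y).2 hy⟩
  have hspan : LinearMap.ker Q.polarBilin = K ∙ y := by
    refine le_antisymm (fun x hx ↦ ?_) ((Submodule.span_singleton_le_iff_mem _ _).2 ((hker y).2 hy))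
    obtain ⟨c, hc⟩ := FiniteField.isSquare_of_char_two h2 (Q x / Q y)
    have hmem : x - c • y ∈ Q.radical := by
      refine ⟨?_, sub_mem hx (Submodule.smul_mem _ _ ((hker y).2 hy))⟩
      have h3 : QuadraticMap.polar Q x (-(c • y)) = 0 := (hker x).1 hx _
      rw [sub_eq_add_neg, QuadraticMap.map_add Q, h3, QuadraticMap.map_neg, QuadraticMap.map_smul,
        smul_eq_mul, ← hc, div_mul_cancel₀ _ hyQ, add_zero, CharTwo.add_self_eq_zero]
    rw [hQ, Submodule.mem_bot, sub_eq_zero] at hmem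
    exact Submodule.mem_span_singleton.2 ⟨c, hmem.symm⟩
  have hpar := even_finrank_add_finrank_ker (B := Q.polarBilin) fun v ↦ by simpa using h0 v
  rw [hspan, finrank_span_singleton hy0, Nat.even_add_one] at hpar
  exact hpar hV

end Polar

/-! ### Dependence of the exponential sum on the scalar -/

section Evaluation

variable {k : Type*} [Field k] [Fintype k] {ψ : AddChar k ℂ} {V : Type*} [AddCommGroup V]
  [Module k V] [Fintype V]

omit [Fintype k] in
theorem quadraticSum_mul_sq (Q : QuadraticForm k V) (t : k) {c : k} (hc : c ≠ 0) :
    quadraticSum ψ Q (t * (c * c)) = quadraticSum ψ Q t := by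
  rw [quadraticSum, quadraticSum,
    ← Equiv.sum_comp (LinearEquiv.smulOfNeZero k V c hc).toEquiv fun v ↦ ψ (t * Q v)]
  refine Finset.sum_congr rfl fun v _ ↦ ?_
  simp [QuadraticMap.map_smul, mul_assoc]

omit [Fintype k] in
theorem addChar_sum {ι : Type*} (s : Finset ι) (f : ι → k) :
    ψ (∑ i ∈ s, f i) = ∏ i ∈ s, ψ (f i) := by
  classical
  induction s using Finset.induction_on with
  | empty => simp
  | insert i s hi ih => rw [Finset.sum_insert hi, Finset.prod_insert hi, AddChar.map_add_eq_mul, ih]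

open scoped Classical in
theorem sum_erase_addChar_inv (hψ : ψ ≠ 1) (c : k) :
    ∑ t ∈ Finset.univ.erase (0 : k), ψ (-(t⁻¹ * c)) =
      (if c = 0 then (Fintype.card k : ℂ) else 0) - 1 := by
  have h1 : ∑ t ∈ Finset.univ.erase (0 : k), ψ (-(t⁻¹ * c)) =
      ∑ t ∈ Finset.univ.erase (0 : k), ψ (t * c) :=
    Finset.sum_nbij' (fun t ↦ -t⁻¹) (fun t ↦ -t⁻¹) (by simp) (by simp) (by simp) (by simp)
      (by simp)
  have h2 := Finset.add_sum_erase Finset.univ (fun t ↦ ψ (t * c)) (Finset.mem_univ (0 : k))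
  rw [h1, eq_sub_iff_add_eq, add_comm]
  simp only [zero_mul, AddChar.map_zero_eq_one] at h2
  rw [h2]
  split_ifs with hc
  · simp [hc]
  · exact sum_addChar_mul hψ hc

open scoped Classical in
theorem card_mul_sum_isotropic_polar_of_const (hψ : ψ ≠ 1) {Q : QuadraticForm k V}
    (hQ : ∀ y, (∀ x, QuadraticMap.polar Q y x = 0) → y = 0)
    (hG : ∀ t, t ≠ 0 → quadraticSum ψ Q t = quadraticSum ψ Q 1) {y : V} (hy : y ≠ 0) :
    (Fintype.card k : ℂ) * ∑ v with Q v = 0, ψ (QuadraticMap.polar Q y v) =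
      quadraticSum ψ Q 1 * ((if Q y = 0 then (Fintype.card k : ℂ) else 0) - 1) := by
  rw [card_mul_sum_isotropic_polar hψ hQ hy, ← sum_erase_addChar_inv hψ, Finset.mul_sum]
  exact Finset.sum_congr rfl fun t ht ↦ by rw [hG t (Finset.ne_of_mem_erase ht)]

section OddCharacteristic

variable (h2 : ringChar k ≠ 2)

include h2

open scoped Classical in
-- An element `y` has `quadraticChar k y + 1` square roots.
theorem sum_apply_sq (F : k → ℂ) :
    ∑ x, F (x * x) = ∑ y, ((quadraticChar k y : ℂ) + 1) * F y := by
  rw [← Finset.sum_fiberwise Finset.univ (fun x : k ↦ x * x) fun x ↦ F (x * x)]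
  refine Finset.sum_congr rfl fun y _ ↦ ?_
  have h := quadraticChar_card_sqrts h2 y
  rw [Finset.sum_congr rfl (g := fun _ ↦ F y) fun x hx ↦ by rw [(Finset.mem_filter.1 hx).2],
    Finset.sum_const, nsmul_eq_mul]
  congr 1
  have h' : (((Finset.univ.filter fun x : k ↦ x * x = y).card : ℕ) : ℤ) = quadraticChar k y + 1 := by
    rw [← h]
    congr 2
    ext x
    simp [sq]
  exact_mod_cast congrArg (Int.cast : ℤ → ℂ) h'

open scoped Classical in
theorem sum_addChar_sq (hψ : ψ ≠ 1) {a : k} (ha : a ≠ 0) :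
    ∑ x, ψ (a * (x * x)) = quadraticChar k a * ∑ y, (quadraticChar k y : ℂ) * ψ y := by
  rw [sum_apply_sq h2 fun y ↦ ψ (a * y)]
  simp only [add_mul, one_mul, Finset.sum_add_distrib]
  have h1 : ∑ y, ψ (a * y) = 0 := by simpa only [mul_comm] using sum_addChar_mul hψ ha
  rw [h1, add_zero, Finset.mul_sum, ← Equiv.sum_comp (Equiv.mulLeft₀ a⁻¹ (inv_ne_zero ha))
    fun y ↦ (quadraticChar k y : ℂ) * ψ (a * y)]
  refine Finset.sum_congr rfl fun y _ ↦ ?_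
  have h3 : (quadraticChar k a⁻¹ : ℂ) = quadraticChar k a := by
    have h4 := quadraticChar_sq_one ha
    have h5 : quadraticChar k a⁻¹ * quadraticChar k a = 1 := by
      rw [← map_mul, inv_mul_cancel₀ ha, map_one]
    have h6 : quadraticChar k a⁻¹ = quadraticChar k a := by
      linear_combination (quadraticChar k a) * h5 - (quadraticChar k a⁻¹) * h4
    rw [h6]
  simp only [Equiv.mulLeft₀_apply, map_mul, Int.cast_mul, h3]
  rw [mul_inv_cancel_left₀ ha, mul_assoc]

open scoped Classical in
-- Diagonalising `Q` factors the sum into one-dimensional Gauss sums, each contributing one factor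
-- `quadraticChar k t`.
theorem quadraticSum_mul_of_odd [FiniteDimensional k V] (hψ : ψ ≠ 1) {Q : QuadraticForm k V}
    (hQ : Q.radical = ⊥) {t : k} (ht : t ≠ 0) :
    quadraticSum ψ Q t = (quadraticChar k t : ℂ) ^ finrank k V * quadraticSum ψ Q 1 := by
  have := invertibleOfNonzero (Ring.two_ne_zero h2)
  have hsep : (QuadraticMap.associated (R := k) Q).SeparatingLeft := by
    rw [LinearMap.separatingLeft_iff_ker_eq_bot, ← QuadraticMap.radical_eq_ker_associated, hQ]
  obtain ⟨w, ⟨f⟩⟩ := QuadraticForm.equivalent_weightedSumSquares_units_of_nondegenerate' Q hsep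
  have key : ∀ t, quadraticSum ψ Q t = ∏ i, ∑ x, ψ (t * w i * (x * x)) := fun t ↦ by
    rw [Finset.prod_univ_sum, Fintype.piFinset_univ, quadraticSum,
      ← Equiv.sum_comp f.toLinearEquiv.symm.toEquiv]
    refine Finset.sum_congr rfl fun v _ ↦ ?_
    have h1 : Q (f.toLinearEquiv.symm.toEquiv v) = QuadraticMap.weightedSumSquares k w v :=
      f.symm.map_app v
    rw [h1, QuadraticMap.weightedSumSquares_apply, Finset.mul_sum, addChar_sum]
    simp [Units.smul_def, mul_assoc]
  rw [key, key]
  simp only [one_mul]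
  rw [Finset.prod_congr rfl fun i _ ↦ sum_addChar_sq h2 hψ (mul_ne_zero ht (w i).ne_zero),
    Finset.prod_congr rfl fun i _ ↦ sum_addChar_sq h2 hψ (w i).ne_zero]
  simp only [map_mul, Int.cast_mul, mul_assoc, Finset.prod_mul_distrib, Finset.prod_const,
    Finset.card_univ, Fintype.card_fin]

open scoped Classical in
theorem quadraticSum_eq_of_even [FiniteDimensional k V] (hψ : ψ ≠ 1) {Q : QuadraticForm k V}
    (hQ : Q.radical = ⊥) (hV : Even (finrank k V)) {t : k} (ht : t ≠ 0) :
    quadraticSum ψ Q t = quadraticSum ψ Q 1 := by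
  obtain ⟨r, hr⟩ := hV
  rw [quadraticSum_mul_of_odd h2 hψ hQ ht, hr, ← two_mul, pow_mul, ← Int.cast_pow,
    quadraticChar_sq_one ht]
  simp

end OddCharacteristic

end Evaluation

end QuasiPolar


namespace QuasiPolar

/-! ### From character sums to section sizes -/

section SectionValues

variable {K V : Type*} [Field K] [Fintype K] [AddCommGroup V] [Module K V] [Fintype V]
  {ψ : AddChar K ℂ}

open scoped Classical in
theorem ncard_inter_ker_eq (hψ : ψ ≠ 1) {Z : Set V}
    (hZ : ∀ c : K, c ≠ 0 → ∀ v, c • v ∈ Z ↔ v ∈ Z) (φ : Dual K V) :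
    ((Z ∩ LinearMap.ker φ).ncard : ℂ) =
      (((Fintype.card K : ℂ) - 1) * ∑ v with v ∈ Z, ψ (φ v) + Z.ncard) / Fintype.card K := by
  have h := sub_one_mul_sum_addChar hψ (f := fun v ↦ if v ∈ Z then 1 else 0)
    (fun c hc v ↦ by simp only [hZ c hc]) φ
  simp only [ite_mul, one_mul, zero_mul, ← Finset.sum_filter, Finset.sum_const, nsmul_one] at h
  have h1 : ((Finset.univ.filter (φ · = 0)).filter (· ∈ Z)).card = (Z ∩ LinearMap.ker φ).ncard := by
    rw [Set.ncard_eq_toFinset_card']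
    congr 1
    ext v
    simp [and_comm]
  have h2 : (Finset.univ.filter (· ∈ Z)).card = Z.ncard := by
    rw [Set.ncard_eq_toFinset_card']
    congr 1
    ext v
    simp
  rw [h1, h2] at h
  rw [eq_div_iff (by simp), h]
  ring

theorem ncard_range_of_ite {k : Type*} [Field k] {val : k → ℂ} {a b : ℂ} (h0 : val 0 = a)
    (h1 : ∀ c, c ≠ 0 → val c = b) (hab : a ≠ b) : (Set.range val).ncard = 2 := by
  have : Set.range val = {a, b} := by
    ext z
    constructor
    · rintro ⟨c, rfl⟩
      rcases eq_or_ne c 0 with rfl | hc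
      · exact Or.inl h0
      · exact Or.inr (h1 c hc)
    · rintro (rfl | rfl)
      · exact ⟨0, h0⟩
      · exact ⟨1, h1 1 one_ne_zero⟩
  rw [this, Set.ncard_pair hab]

open scoped Classical in
/-- The number of vectors in the hyperplane section of a two-intersection polar space with the
hyperplane orthogonal to a vector on which the form takes the value `c`. -/
noncomputable def sectionValue {k : Type*} [Field k] (q s G N : ℂ) (c : k) : ℂ :=
  ((q - 1) * (G * ((if c = 0 then s else 0) - 1) / s) + N) / q

theorem ncard_range_sectionValue {k : Type*} [Field k] {q s G N : ℂ} (hq0 : q ≠ 0) (hq1 : q ≠ 1)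
    (hs : s ≠ 0) (hG : G ≠ 0) : (Set.range (sectionValue (k := k) q s G N)).ncard = 2 := by
  refine ncard_range_of_ite rfl (b := sectionValue q s G N (1 : k)) (fun c hc ↦ ?_) ?_
  · simp [sectionValue, hc]
  · simp only [sectionValue, if_true, one_ne_zero, if_false]
    intro h
    have h1 := sub_ne_zero.2 hq1
    field_simp at h
    have h2 := add_right_cancel h
    have h3 : (q - 1) * G * s = 0 := by linear_combination h2
    simp_all

end SectionValues

/-! ### Section sizes of quadrics -/

section Quadric

variable {K V : Type*} [Field K] [Finite K] [AddCommGroup V] [Module K V]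
  [FiniteDimensional K V]

omit [Finite K] [FiniteDimensional K V] in
theorem isPolarModel_of_quadraticForm {Q : QuadraticForm K V}
    (hQ : ∀ y, (∀ x, QuadraticMap.polar Q y x = 0) → y = 0) {val : K → ℂ}
    (hval : ∀ y, y ≠ 0 → (({v | Q v = 0} ∩ LinearMap.ker (Q.polarBilin y)).ncard : ℂ) =
      val (Q y)) :
    IsPolarModel (σ := RingHom.id K) Q.polarBilin Q val {v | Q v = 0} where
  mem_iff v := Iff.rfl
  eq_zero y hy := hQ y (by simpa using hy)
  symm x y h := by
    rw [QuadraticMap.polarBilin_apply_apply] at h ⊢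
    rwa [QuadraticMap.polar_comm]
  self x h := by simp [h]
  tangent x y c hx hxy := by
    rw [QuadraticMap.polarBilin_apply_apply] at hxy
    rw [QuadraticMap.map_add Q, QuadraticMap.map_smul, QuadraticMap.polar_smul_right, hx, hxy]
    simp
  secant x y a hx hxy := by
    rw [QuadraticMap.polarBilin_apply_apply] at hxy
    refine ⟨(a - Q y) / QuadraticMap.polar Q y x, ?_⟩
    rw [QuadraticMap.map_add Q, QuadraticMap.map_smul, QuadraticMap.polar_smul_right, hx,
      smul_zero, add_zero, smul_eq_mul, div_mul_cancel₀ _ hxy, add_sub_cancel]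
  ncard_section := hval

omit [Finite K] [FiniteDimensional K V] in
theorem smul_mem_zeros_iff (Q : QuadraticForm K V) {c : K} (hc : c ≠ 0) (v : V) :
    c • v ∈ {v | Q v = 0} ↔ v ∈ {v | Q v = 0} := by
  simp [QuadraticMap.map_smul, hc]

/-- The exponential sum does not depend on `t ≠ 0`, so a section only depends on whether `Q y`
vanishes. -/
theorem exists_isPolarModel_of_even {Q : QuadraticForm K V} (hQ : Q.radical = ⊥)
    (hV : Even (finrank K V)) : ∃ val : K → ℂ,
      IsPolarModel (σ := RingHom.id K) Q.polarBilin Q val {v | Q v = 0} ∧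
        (Set.range val).ncard = 2 := by
  classical
  have : Finite V := Module.finite_of_finite K
  have : Fintype V := Fintype.ofFinite V
  have : Fintype K := Fintype.ofFinite K
  obtain ⟨ψ, hψ⟩ := exists_addChar_ne_one K
  have hnd := polar_nondegenerate_of_even hQ hV
  have hG : ∀ t, t ≠ 0 → quadraticSum ψ Q t = quadraticSum ψ Q 1 := fun t ht ↦ by
    by_cases h2 : ringChar K = 2
    · obtain ⟨c, rfl⟩ := FiniteField.isSquare_of_char_two h2 t
      rw [← quadraticSum_mul_sq Q 1 (left_ne_zero_of_mul ht), one_mul]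
    · exact quadraticSum_eq_of_even h2 hψ hQ hV ht
  have hq0 : (Fintype.card K : ℂ) ≠ 0 := by simp
  have hq1 : (Fintype.card K : ℂ) ≠ 1 := by exact_mod_cast (Fintype.one_lt_card (α := K)).ne'
  refine ⟨sectionValue (Fintype.card K) (Fintype.card K) (quadraticSum ψ Q 1)
    {v | Q v = 0}.ncard, isPolarModel_of_quadraticForm hnd fun y hy ↦ ?_,
    ncard_range_sectionValue hq0 hq1 hq0 (quadraticSum_ne_zero hψ hnd one_ne_zero)⟩
  have h1 := card_mul_sum_isotropic_polar_of_const hψ hnd hG hy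
  rw [mul_comm, ← eq_div_iff hq0] at h1
  rw [ncard_inter_ker_eq hψ (fun c hc ↦ smul_mem_zeros_iff Q hc)]
  simp only [QuadraticMap.polarBilin_apply_apply, Set.mem_ofPred_eq]
  rw [h1, sectionValue]

/-- In odd dimension `quadraticChar K t` survives in the exponential sum, and summing over `t` gives
a Gauss sum proportional to `quadraticChar K (Q y)`, with values 0, 1 and -1. -/
theorem exists_isPolarModel_of_odd {Q : QuadraticForm K V} (hQ : Q.radical = ⊥)
    (h2 : ringChar K ≠ 2) (hV : Odd (finrank K V)) : ∃ val : K → ℂ,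
      IsPolarModel (σ := RingHom.id K) Q.polarBilin Q val {v | Q v = 0} ∧
        (Set.range val).ncard = 3 := by
  classical
  have : Finite V := Module.finite_of_finite K
  have : Fintype V := Fintype.ofFinite V
  have : Fintype K := Fintype.ofFinite K
  obtain ⟨ψ, hψ⟩ := exists_addChar_ne_one K
  have hnd := polar_nondegenerate_of_odd hQ h2
  set G := quadraticSum ψ Q 1 with hG_def
  have hG0 : G ≠ 0 := quadraticSum_ne_zero hψ hnd one_ne_zero
  set g := ∑ y, (quadraticChar K y : ℂ) * ψ y with hg_def
  -- The Gauss sum is the exponential sum of the form `x ^ 2` on a line, so it cannot vanish.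
  have hg0 : g ≠ 0 := by
    have h1 : quadraticSum ψ (QuadraticMap.sq (R := K)) 1 = g := by
      have := sum_addChar_sq h2 hψ (one_ne_zero (α := K))
      rw [map_one, Int.cast_one, one_mul] at this
      rw [quadraticSum, hg_def, ← this]
      simp
    rw [← h1]
    refine quadraticSum_ne_zero hψ (polar_nondegenerate_of_odd ?_ h2) one_ne_zero
    rw [Submodule.eq_bot_iff]
    rintro x ⟨hx, -⟩
    simpa using hx
  have hsq : ∀ t : K, t ≠ 0 → (quadraticChar K t : ℂ) ^ finrank K V = quadraticChar K t :=
    fun t ht ↦ by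
      obtain ⟨r, hr⟩ := hV
      rw [hr, pow_succ, pow_mul, ← Int.cast_pow, quadraticChar_sq_one ht]
      simp
  have hneg : ((quadraticChar K (-1) : ℤ) : ℂ) ≠ 0 := by
    rw [Int.cast_ne_zero, Ne, quadraticChar_eq_zero_iff]
    simp
  have hsum : ∀ c : K, ∑ t ∈ Finset.univ.erase (0 : K), quadraticSum ψ Q t * ψ (-(t⁻¹ * c)) =
      G * g * quadraticChar K (-1) * quadraticChar K c := fun c ↦ by
    have h1 : ∑ t ∈ Finset.univ.erase (0 : K), quadraticSum ψ Q t * ψ (-(t⁻¹ * c)) =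
        ∑ t ∈ Finset.univ.erase (0 : K), G * ((quadraticChar K (-1) : ℂ) *
          ((quadraticChar K t : ℂ) * ψ (c * t))) := by
      refine Finset.sum_nbij' (fun t ↦ -t⁻¹) (fun t ↦ -t⁻¹) (by simp) (by simp) (by simp)
        (by simp) fun t ht ↦ ?_
      have ht0 := Finset.ne_of_mem_erase ht
      have h3 : quadraticChar K t = quadraticChar K (-1) * quadraticChar K (-t⁻¹) := by
        rw [← map_mul, neg_one_mul, neg_neg, ← mul_one (quadraticChar K t⁻¹),
          ← quadraticChar_sq_one ht0, sq, ← mul_assoc, ← map_mul, inv_mul_cancel₀ ht0, map_one,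
          one_mul]
      rw [quadraticSum_mul_of_odd h2 hψ hQ ht0, hsq t ht0, h3]
      push_cast
      rw [show c * -t⁻¹ = -(t⁻¹ * c) by ring]
      ring
    have h4 : ∑ t ∈ Finset.univ.erase (0 : K), G * ((quadraticChar K (-1) : ℂ) *
          ((quadraticChar K t : ℂ) * ψ (c * t))) =
        G * (quadraticChar K (-1) * ∑ t, (quadraticChar K t : ℂ) * ψ (c * t)) := by
      rw [Finset.mul_sum, Finset.mul_sum]
      refine Finset.sum_erase _ (by simp)
    have h5 : ∑ t, (quadraticChar K t : ℂ) * ψ (c * t) = quadraticChar K c * g := by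
      rcases eq_or_ne c 0 with rfl | hc
      · have := quadraticChar_sum_zero h2
        simp only [zero_mul, AddChar.map_zero_eq_one, mul_one, MulChar.map_zero, Int.cast_zero]
        exact_mod_cast this
      · rw [← sum_addChar_sq h2 hψ hc, sum_apply_sq h2 fun y ↦ ψ (c * y)]
        have h6 : ∑ y, ψ (c * y) = 0 := by simpa only [mul_comm] using sum_addChar_mul hψ hc
        simp only [add_mul, one_mul, Finset.sum_add_distrib, h6, add_zero]
    rw [h1, h4, h5]
    ring
  have hq0 : (Fintype.card K : ℂ) ≠ 0 := by simp
  have hq1 : (Fintype.card K : ℂ) - 1 ≠ 0 := by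
    rw [sub_ne_zero]
    exact_mod_cast (Fintype.one_lt_card (α := K)).ne'
  set F : ℂ → ℂ := fun z ↦ (((Fintype.card K : ℂ) - 1) *
    (G * g * quadraticChar K (-1) * z / Fintype.card K) + {v | Q v = 0}.ncard) / Fintype.card K
    with hF
  have hFinj : Function.Injective F := fun a b hab ↦ by
    simp only [hF] at hab
    have h1 := add_right_cancel ((div_left_inj' hq0).1 hab)
    have h2 := (div_left_inj' hq0).1 (mul_left_cancel₀ hq1 h1)
    exact mul_left_cancel₀ (mul_ne_zero (mul_ne_zero hG0 hg0) hneg) h2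
  refine ⟨fun c ↦ F (quadraticChar K c), isPolarModel_of_quadraticForm hnd fun y hy ↦ ?_, ?_⟩
  · have h1 := card_mul_sum_isotropic_polar hψ hnd hy
    rw [hsum, mul_comm, ← eq_div_iff hq0] at h1
    rw [ncard_inter_ker_eq hψ (fun c hc ↦ smul_mem_zeros_iff Q hc)]
    simp only [QuadraticMap.polarBilin_apply_apply, Set.mem_ofPred_eq]
    rw [h1]
  · have h1 : Set.range (fun c ↦ F (quadraticChar K c)) = F '' {0, 1, -1} := by
      ext z
      constructor
      · rintro ⟨c, rfl⟩
        refine ⟨_, ?_, rfl⟩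
        rcases eq_or_ne c 0 with rfl | hc
        · simp
        · rcases quadraticChar_dichotomy hc with h | h <;> simp [h]
      · rintro ⟨z, rfl | rfl | rfl, rfl⟩
        · exact ⟨0, by simp⟩
        · exact ⟨1, by simp⟩
        · obtain ⟨a, ha⟩ := quadraticChar_exists_neg_one h2
          exact ⟨a, by simp [ha]⟩
    rw [h1, Set.ncard_image_of_injective _ hFinj, Set.ncard_eq_toFinset_card']
    simp only [Set.toFinset_insert, Set.toFinset_singleton]
    rw [Finset.card_eq_three]
    exact ⟨0, 1, -1, by norm_num, by norm_num, by norm_num, rfl⟩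

end Quadric

end QuasiPolar


namespace QuasiPolar

/-! ### Trace and norm of an involution of a finite field -/

section Involution

variable {K : Type*} [Field K] (σ : K →+* K)

/-- The fixed field of a field endomorphism. -/
abbrev fixedSubfield : Subfield K := RingHom.eqLocusField σ (RingHom.id K)

variable {σ} (hσ : σ ≠ RingHom.id K) (hσσ : σ.comp σ = RingHom.id K)

theorem mem_fixedSubfield {x : K} : x ∈ fixedSubfield σ ↔ σ x = x := Iff.rfl

include hσσ in
theorem involution_apply_apply (x : K) : σ (σ x) = x := DFunLike.congr_fun hσσ x

/-- The trace of an involution to its fixed field. -/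
def involutionTrace (hσσ : σ.comp σ = RingHom.id K) : K →+ fixedSubfield σ where
  toFun z := ⟨z + σ z, mem_fixedSubfield.2 (by
    rw [map_add, involution_apply_apply hσσ, add_comm])⟩
  map_zero' := by ext; simp
  map_add' x y := by ext; simp; ring

theorem coe_involutionTrace (z : K) : (involutionTrace hσσ z : K) = z + σ z := rfl

theorem involutionTrace_mul (a : fixedSubfield σ) (z : K) :
    involutionTrace hσσ (a * z) = a * involutionTrace hσσ z := by
  ext
  simp only [coe_involutionTrace, map_mul, Subfield.coe_mul, mem_fixedSubfield.1 a.2]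
  ring

include hσ

theorem exists_involution_eq_neg : ∃ δ : K, δ ≠ 0 ∧ (σ.comp σ = RingHom.id K → σ δ = -δ) := by
  obtain ⟨x, hx⟩ : ∃ x, σ x ≠ x := by
    by_contra! h
    exact hσ (RingHom.ext h)
  refine ⟨x - σ x, sub_ne_zero.2 (Ne.symm hx), fun hσσ ↦ ?_⟩
  rw [map_sub, involution_apply_apply hσσ, neg_sub]

theorem involutionTrace_surjective : Function.Surjective (involutionTrace hσσ) := by
  obtain ⟨z, hz⟩ : ∃ z, involutionTrace hσσ z ≠ 0 := by
    by_contra! h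
    refine hσ (RingHom.ext fun z ↦ ?_)
    have h1 : (1 : K) + σ 1 = 0 := congrArg Subtype.val (h 1)
    have hz : z + σ z = 0 := congrArg Subtype.val (h z)
    rw [map_one] at h1
    have h2 : z + z = 0 := by linear_combination z * h1
    rw [RingHom.id_apply]
    exact add_left_cancel (hz.trans h2.symm)
  intro a
  refine ⟨((a / involutionTrace hσσ z : fixedSubfield σ) : K) * z, ?_⟩
  rw [involutionTrace_mul, div_mul_cancel₀ _ hz]

include hσσ in
-- An element `z` of trace 1 and an element `δ` of trace 0 form a basis over the fixed field.
theorem card_eq_card_fixedSubfield_sq :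
    Nat.card K = Nat.card (fixedSubfield σ) ^ 2 := by
  obtain ⟨z, hz⟩ := involutionTrace_surjective hσ hσσ 1
  obtain ⟨δ, hδ, hσδ⟩ := exists_involution_eq_neg hσ
  have hδ' := hσδ hσσ
  have htrδ : involutionTrace hσσ δ = 0 := by
    ext
    rw [coe_involutionTrace, hδ', add_neg_cancel]
    rfl
  have htr : ∀ a b : fixedSubfield σ, involutionTrace hσσ (a * z + b * δ) = a := fun a b ↦ by
    rw [map_add, involutionTrace_mul, involutionTrace_mul, hz, htrδ, mul_one, mul_zero, add_zero]
  have hbij : Function.Bijective fun x : fixedSubfield σ × fixedSubfield σ ↦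
      (x.1 : K) * z + x.2 * δ := by
    constructor
    · rintro ⟨a, b⟩ ⟨a', b'⟩ h
      simp only at h
      have h1 : a = a' := by rw [← htr a b, h, htr]
      subst h1
      have h2 := mul_right_cancel₀ hδ (add_left_cancel h)
      rw [Subtype.ext h2]
    · intro x
      have h1 : involutionTrace hσσ (x - involutionTrace hσσ x * z) = 0 := by
        rw [map_sub, involutionTrace_mul, hz, mul_one, sub_self]
      have h2 : (x - involutionTrace hσσ x * z) + σ (x - involutionTrace hσσ x * z) = 0 :=
        congrArg Subtype.val h1
      refine ⟨(involutionTrace hσσ x, ⟨(x - involutionTrace hσσ x * z) / δ, ?_⟩), ?_⟩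
      · rw [mem_fixedSubfield, map_div₀, hδ', eq_neg_of_add_eq_zero_right h2, neg_div_neg_eq]
      · simp only
        rw [div_mul_cancel₀ _ hδ, add_sub_cancel]
  rw [sq, ← Nat.card_prod, Nat.card_congr (Equiv.ofBijective _ hbij)]

open Polynomial in
include hσσ in
-- In characteristic 2, take a square root in the fixed field. Otherwise the norm of `a + b * δ` is
-- `a ^ 2 - D * b ^ 2` with `D = δ ^ 2`, and this binary form represents every `t`.
theorem exists_norm_eq [Finite K] (t : fixedSubfield σ) : ∃ c : K, σ c * c = t := by
  have : Fintype (fixedSubfield σ) := Fintype.ofFinite _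
  by_cases h2 : ringChar (fixedSubfield σ) = 2
  · obtain ⟨c, rfl⟩ := FiniteField.isSquare_of_char_two h2 t
    exact ⟨c, by rw [mem_fixedSubfield.1 c.2]; rfl⟩
  · obtain ⟨δ, hδ, hσδ⟩ := exists_involution_eq_neg hσ
    have hδ' := hσδ hσσ
    set D : fixedSubfield σ := ⟨δ * δ, mem_fixedSubfield.2 (by rw [map_mul, hδ', neg_mul_neg])⟩
      with hD
    have hD0 : D ≠ 0 := fun h ↦ mul_ne_zero hδ hδ (congrArg Subtype.val h)
    obtain ⟨a, b, hab⟩ := FiniteField.exists_root_sum_quadratic (R := fixedSubfield σ)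
      (f := X ^ 2 - C t) (g := C (-D) * X ^ 2) (degree_X_pow_sub_C (by decide) _)
      (degree_C_mul_X_pow _ (neg_ne_zero.2 hD0)) (FiniteField.odd_card_of_char_ne_two h2)
    simp only [eval_sub, eval_pow, eval_X, eval_C, eval_mul] at hab
    have hab' : (a : K) ^ 2 - t + -(δ * δ) * (b : K) ^ 2 = 0 := congrArg Subtype.val hab
    refine ⟨a + b * δ, ?_⟩
    rw [map_add, map_mul, hδ', mem_fixedSubfield.1 a.2, mem_fixedSubfield.1 b.2]
    linear_combination hab'

end Involution

/-! ### Section sizes and point counts of Hermitian varieties -/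

section Hermitian

variable {K V : Type*} [Field K] [AddCommGroup V] [Module K V] {σ : K →+* K}
  {B : V →ₛₗ[σ] V →ₗ[K] K}

/-- A Hermitian form as a quadratic form over the fixed field of the involution. -/
def hermitianQuadraticForm (hB : B.IsSymm) : QuadraticForm (fixedSubfield σ) V :=
  QuadraticMap.ofPolar (fun v ↦ ⟨B v v, mem_fixedSubfield.2 (hB.eq v v)⟩)
    (fun a v ↦ by
      ext
      simp only [Subfield.smul_def, LinearMap.map_smulₛₗ, LinearMap.smul_apply, smul_eq_mul,
        mem_fixedSubfield.1 a.2, Subfield.coe_mul, RingHom.id_apply]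
      ring)
    (fun x y z ↦ by
      ext
      simp [QuadraticMap.polar]
      ring)
    (fun a x y ↦ by
      ext
      simp [QuadraticMap.polar, Subfield.smul_def, mem_fixedSubfield.1 a.2]
      ring)

theorem coe_hermitianQuadraticForm (hB : B.IsSymm) (v : V) :
    (hermitianQuadraticForm hB v : K) = B v v := rfl

theorem polar_hermitianQuadraticForm (hσσ : σ.comp σ = RingHom.id K) (hB : B.IsSymm) (x y : V) :
    QuadraticMap.polar (hermitianQuadraticForm hB) x y = involutionTrace hσσ (B x y) := by
  ext
  simp only [QuadraticMap.polar, Subfield.coe_sub, coe_hermitianQuadraticForm, map_add,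
    LinearMap.add_apply, coe_involutionTrace, hB.eq]
  ring

theorem hermitianQuadraticForm_add_smul (hσσ : σ.comp σ = RingHom.id K) (hB : B.IsSymm) (x y : V)
    (c : K) (hx : hermitianQuadraticForm hB x = 0) :
    hermitianQuadraticForm hB (y + c • x) =
      hermitianQuadraticForm hB y + involutionTrace hσσ (c * B y x) := by
  have hx' : B x x = 0 := congrArg Subtype.val hx
  rw [QuadraticMap.map_add (hermitianQuadraticForm hB), polar_hermitianQuadraticForm hσσ,
    (B y).map_smul, smul_eq_mul]
  have : hermitianQuadraticForm hB (c • x) = 0 := by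
    ext
    simp [coe_hermitianQuadraticForm, hx']
  rw [this, add_zero]

variable (hσ : σ ≠ RingHom.id K) (hσσ : σ.comp σ = RingHom.id K) (hB : B.IsSymm)
  (hnd : B.Nondegenerate)

include hσ hσσ hnd

theorem hermitianQuadraticForm_polar_nondegenerate (y : V)
    (hy : ∀ x, QuadraticMap.polar (hermitianQuadraticForm hB) y x = 0) : y = 0 := by
  refine hnd.1 y fun x ↦ ?_
  by_contra hx
  obtain ⟨z, hz⟩ := involutionTrace_surjective hσ hσσ 1
  have := hy ((z / B y x) • x)
  rw [polar_hermitianQuadraticForm hσσ, map_smul, smul_eq_mul, div_mul_cancel₀ _ hx, hz] at this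
  exact one_ne_zero this

omit hnd in
-- Writing `t` as the norm of `c`, the substitution of `c • v` for `v` removes it.
theorem quadraticSum_hermitianQuadraticForm [Finite K] [Fintype V]
    {ψ : AddChar (fixedSubfield σ) ℂ} (t : fixedSubfield σ) (ht : t ≠ 0) :
    quadraticSum ψ (hermitianQuadraticForm hB) t =
      quadraticSum ψ (hermitianQuadraticForm hB) 1 := by
  obtain ⟨c, hc⟩ := exists_norm_eq hσ hσσ t
  have hc0 : c ≠ 0 := by
    rintro rfl
    rw [mul_zero] at hc
    exact ht (Subtype.ext hc.symm)
  rw [quadraticSum, quadraticSum, ← Equiv.sum_comp (LinearEquiv.smulOfNeZero K V c hc0).toEquiv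
    fun v ↦ ψ (1 * hermitianQuadraticForm hB v)]
  refine Finset.sum_congr rfl fun v _ ↦ ?_
  congr 1
  ext
  simp only [one_mul, Subfield.coe_mul, ← hc, coe_hermitianQuadraticForm]
  simp
  ring

theorem exists_isPolarModel_hermitian [Finite K] [FiniteDimensional K V] :
    ∃ val : fixedSubfield σ → ℂ,
      IsPolarModel B (hermitianQuadraticForm hB) val {v | B v v = 0} ∧
        (Set.range val).ncard = 2 := by
  classical
  have : Finite V := Module.finite_of_finite K
  have : Fintype V := Fintype.ofFinite V
  have : Fintype K := Fintype.ofFinite K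
  have : Fintype (fixedSubfield σ) := Fintype.ofFinite _
  obtain ⟨ψ, hψ⟩ := exists_addChar_ne_one (fixedSubfield σ)
  set Q := hermitianQuadraticForm hB with hQ
  have hmem : ∀ v, B v v = 0 ↔ Q v = 0 := fun v ↦ by
    rw [Subtype.ext_iff, coe_hermitianQuadraticForm]
    rfl
  have hQnd := hermitianQuadraticForm_polar_nondegenerate hσ hσσ hB hnd
  have hG := quadraticSum_hermitianQuadraticForm (ψ := ψ) hσ hσσ hB
  have hq0 : (Fintype.card K : ℂ) ≠ 0 := by simp
  have hs0 : (Fintype.card (fixedSubfield σ) : ℂ) ≠ 0 := Nat.cast_ne_zero.2 Fintype.card_ne_zero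
  have hq1 : (Fintype.card K : ℂ) ≠ 1 := by exact_mod_cast (Fintype.one_lt_card (α := K)).ne'
  -- Composition with the trace turns `ψ` into a nontrivial character of `K`, linking hyperplanes
  -- over `K` with the quadratic form over the fixed field.
  have hψ' : ψ.compAddMonoidHom (involutionTrace hσσ) ≠ 1 := by
    obtain ⟨a, ha⟩ := AddChar.ne_one_iff.1 hψ
    obtain ⟨z, rfl⟩ := involutionTrace_surjective hσ hσσ a
    exact AddChar.ne_one_iff.2 ⟨z, ha⟩
  refine ⟨sectionValue (Fintype.card K) (Fintype.card (fixedSubfield σ)) (quadraticSum ψ Q 1)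
    {v | B v v = 0}.ncard, ⟨hmem, hnd.1, fun x y h ↦ hB.isRefl x y h,
    fun x hx ↦ (hmem x).2 hx, fun x y c hx hxy ↦ ?_, fun x y a hx hxy ↦ ?_, fun y hy ↦ ?_⟩,
    ncard_range_sectionValue hq0 hq1 hs0 (quadraticSum_ne_zero hψ hQnd one_ne_zero)⟩
  · rw [hermitianQuadraticForm_add_smul hσσ hB x y c hx, hxy, mul_zero, map_zero, add_zero]
  · obtain ⟨z, hz⟩ := involutionTrace_surjective hσ hσσ (a - Q y)
    refine ⟨z / B y x, ?_⟩
    rw [hermitianQuadraticForm_add_smul hσσ hB x y _ hx, div_mul_cancel₀ _ hxy, hz, add_sub_cancel]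
  · have h1 := card_mul_sum_isotropic_polar_of_const hψ hQnd hG hy
    rw [mul_comm, ← eq_div_iff hs0] at h1
    rw [ncard_inter_ker_eq hψ' fun c hc v ↦ by simp [hc]]
    simp only [polar_hermitianQuadraticForm hσσ] at h1
    rw [← hQ] at h1
    simp only [AddChar.compAddMonoidHom_apply, Set.mem_ofPred_eq, hmem]
    rw [sectionValue]
    convert congrArg (fun z : ℂ ↦
      (((Fintype.card K : ℂ) - 1) * z + {v | Q v = 0}.ncard) / Fintype.card K) h1

include hB in
-- The isotropic vectors number `s ^ (2 * n - 1)` up to an error governed by an exponential sum of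
-- absolute value `s ^ n`, where `n` is the dimension; its sign is not needed.
theorem le_card_hermitian [Finite K] [FiniteDimensional K V] :
    ∃ s : ℕ, Nat.card K = s ^ 2 ∧ s ^ (2 * finrank K V) ≤
      s * {v | B v v = 0}.ncard + (s - 1) * s ^ finrank K V := by
  classical
  have : Finite V := Module.finite_of_finite K
  have : Fintype V := Fintype.ofFinite V
  have : Fintype (fixedSubfield σ) := Fintype.ofFinite _
  obtain ⟨ψ, hψ⟩ := exists_addChar_ne_one (fixedSubfield σ)
  set Q := hermitianQuadraticForm hB with hQ
  have hmem : {v | B v v = 0} = {v | Q v = 0} := by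
    ext v
    rw [Set.mem_ofPred_eq, Set.mem_ofPred_eq, Subtype.ext_iff, coe_hermitianQuadraticForm]
    rfl
  have hQnd := hermitianQuadraticForm_polar_nondegenerate hσ hσσ hB hnd
  have hG := quadraticSum_hermitianQuadraticForm (ψ := ψ) hσ hσσ hB
  set s := Nat.card (fixedSubfield σ) with hs
  have hK := card_eq_card_fixedSubfield_sq hσ hσσ
  have hV : Fintype.card V = s ^ (2 * finrank K V) := by
    rw [← Nat.card_eq_fintype_card, Module.natCard_eq_pow_finrank (K := K), hK, pow_mul]
  refine ⟨s, hK, ?_⟩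
  have h1 : (s : ℂ) * {v | B v v = 0}.ncard =
      (s ^ (2 * finrank K V) : ℕ) + (s - 1 : ℕ) * quadraticSum ψ Q 1 := by
    have hsum : ∑ t ∈ Finset.univ.erase (0 : fixedSubfield σ), quadraticSum ψ Q t =
        (s - 1 : ℕ) * quadraticSum ψ Q 1 := by
      rw [Finset.sum_congr rfl fun t ht ↦ hG t (Finset.ne_of_mem_erase ht), Finset.sum_const,
        Finset.card_erase_of_mem (Finset.mem_univ _), Finset.card_univ, ← Nat.card_eq_fintype_card,
        nsmul_eq_mul]
    have h := card_mul_card_isotropic hψ Q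
    rw [← Nat.card_eq_fintype_card, ← hs, ← hmem, hV] at h
    rw [h]
    congr 1
    convert hsum
  set G := quadraticSum ψ Q 1
  have h2 : ‖G‖ = s ^ finrank K V := by
    have h3 := quadraticSum_mul_conj hψ hQnd (one_ne_zero)
    rw [Complex.mul_conj, hV, Complex.normSq_eq_norm_sq, pow_mul', Nat.cast_pow, Nat.cast_pow] at h3
    have h4 : ‖G‖ ^ 2 = ((s : ℝ) ^ finrank K V) ^ 2 := by exact_mod_cast h3
    exact (pow_left_inj₀ (norm_nonneg _) (by positivity) two_ne_zero).1 h4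
  have h5 : ((s ^ (2 * finrank K V) : ℕ) : ℂ) =
      ((s * {v | B v v = 0}.ncard : ℕ) : ℂ) - ((s - 1 : ℕ) : ℂ) * G := by
    push_cast at h1 ⊢
    rw [h1]
    ring
  have h6 := congrArg norm h5
  rw [Complex.norm_natCast] at h6
  have h7 : ((s ^ (2 * finrank K V) : ℕ) : ℝ) ≤
      ((s * {v | B v v = 0}.ncard : ℕ) : ℝ) + ((s - 1 : ℕ) : ℝ) * s ^ finrank K V := by
    rw [h6]
    refine (norm_sub_le _ _).trans ?_
    rw [norm_mul, h2, Complex.norm_natCast, Complex.norm_natCast]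
  exact_mod_cast h7

end Hermitian

end QuasiPolar


namespace QuasiPolar

/-! ### Hermitian and parabolic sizes do not coincide -/

section Bounds

variable {K V : Type*} [Field K] [Finite K] [AddCommGroup V] [Module K V]
  [FiniteDimensional K V]

/-- A nonzero quadratic form vanishes on at most two vectors of each line in some direction. -/
theorem card_mul_ncard_zeros_le {Q : QuadraticForm K V} {u : V} (hu : Q u ≠ 0) :
    Nat.card K * {v | Q v = 0}.ncard ≤ 2 * Nat.card V := by
  classical
  have : Finite V := Module.finite_of_finite K
  have : Fintype V := Fintype.ofFinite V
  have : Fintype K := Fintype.ofFinite K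
  rw [Set.ncard_eq_toFinset_card', Nat.card_eq_fintype_card, Nat.card_eq_fintype_card,
    ← Finset.card_univ (α := K), ← Finset.card_univ (α := V), ← Finset.card_product]
  refine Finset.card_le_mul_card_image_of_maps_to (f := fun x : K × V ↦ x.2 + x.1 • u)
    (fun _ _ ↦ Finset.mem_univ _) 2 fun w _ ↦ ?_
  by_contra! hlt
  have hQ : ∀ t : K, Q (w + t • u) = Q w + t * t * Q u + t * QuadraticMap.polar Q w u := fun t ↦ by
    rw [QuadraticMap.map_add Q, QuadraticMap.map_smul, QuadraticMap.polar_smul_right]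
    rfl
  obtain ⟨⟨t₁, v₁⟩, ⟨t₂, v₂⟩, ⟨t₃, v₃⟩, h1, h2, h3, h12, h13, h23⟩ :=
    Finset.two_lt_card_iff.1 hlt
  have key : ∀ t v, (t, v) ∈ (Finset.univ ×ˢ {v | Q v = 0}.toFinset).filter
      (fun x : K × V ↦ x.2 + x.1 • u = w) → v = w + (-t) • u ∧
        Q w + t * t * Q u - t * QuadraticMap.polar Q w u = 0 := fun t v h ↦ by
    simp only [Finset.mem_filter, Finset.mem_product, Finset.mem_univ, true_and, Set.mem_toFinset,
      Set.mem_ofPred_eq] at h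
    have hv : v = w + (-t) • u := by rw [← h.2, neg_smul, add_neg_cancel_right]
    refine ⟨hv, ?_⟩
    rw [hv, hQ] at h
    linear_combination h.1
  obtain ⟨e1, q1⟩ := key _ _ h1
  obtain ⟨e2, q2⟩ := key _ _ h2
  obtain ⟨e3, q3⟩ := key _ _ h3
  have n12 : t₁ - t₂ ≠ 0 := fun h ↦ h12 (by rw [e1, e2, sub_eq_zero.1 h])
  have n13 : t₁ - t₃ ≠ 0 := fun h ↦ h13 (by rw [e1, e3, sub_eq_zero.1 h])
  have n23 : t₂ - t₃ ≠ 0 := fun h ↦ h23 (by rw [e2, e3, sub_eq_zero.1 h])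
  have m12 : (t₁ - t₂) * ((t₁ + t₂) * Q u - QuadraticMap.polar Q w u) = 0 := by
    linear_combination q1 - q2
  have m13 : (t₁ - t₃) * ((t₁ + t₃) * Q u - QuadraticMap.polar Q w u) = 0 := by
    linear_combination q1 - q3
  have l12 := (mul_eq_zero.1 m12).resolve_left n12
  have l13 := (mul_eq_zero.1 m13).resolve_left n13
  have : (t₂ - t₃) * Q u = 0 := by linear_combination l12 - l13
  exact (mul_ne_zero n23 hu) this

/-- On a line `v + K x` off the hyperplane orthogonal to `x`, `Q` is affine with nonzero slope, so
it has at most one zero among q vectors. -/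
theorem card_mul_ncard_zeros_diff_le {Q : QuadraticForm K V} {x : V} (hx : Q x = 0) :
    Nat.card K * ({v | Q v = 0} \ (LinearMap.ker (Q.polarBilin x) : Set V)).ncard ≤
      ((LinearMap.ker (Q.polarBilin x) : Set V)ᶜ).ncard := by
  have : Finite V := Module.finite_of_finite K
  rw [← Set.ncard_univ, ← Set.ncard_prod]
  have hker : ∀ v, v ∈ (LinearMap.ker (Q.polarBilin x) : Set V) ↔ QuadraticMap.polar Q v x = 0 :=
    fun v ↦ by
      rw [SetLike.mem_coe, LinearMap.mem_ker, QuadraticMap.polarBilin_apply_apply,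
        QuadraticMap.polar_comm]
  refine Set.ncard_le_ncard_of_injOn (fun y : K × V ↦ y.2 + y.1 • x) ?_ ?_
  · rintro ⟨t, v⟩ ⟨-, -, hv⟩ hmem
    rw [hker] at hv hmem
    apply hv
    rwa [QuadraticMap.polar_add_left, QuadraticMap.polar_smul_left, QuadraticMap.polar_self, hx,
      smul_zero, smul_zero, add_zero] at hmem
  · rintro ⟨t, v⟩ ⟨-, hv, hv'⟩ ⟨t', v'⟩ ⟨-, hw, -⟩ h
    simp only at h hv hv' hw
    rw [hker] at hv'
    rw [Set.mem_ofPred_eq] at hv hw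
    have hvv : v' = v + (t - t') • x := by
      rw [sub_smul, ← add_sub_assoc, h, add_sub_cancel_right]
    rw [hvv, QuadraticMap.map_add Q, QuadraticMap.map_smul, QuadraticMap.polar_smul_right, hx, hv,
      smul_zero, zero_add, zero_add, smul_eq_mul] at hw
    have ht := sub_eq_zero.1 ((mul_eq_zero.1 hw).resolve_right hv')
    rw [hvv, ht, sub_self, zero_smul, add_zero]

/-- If every singular vector is in the kernel of the polar form, the zeros form a subspace.
Otherwise let H be orthogonal to a singular `x` outside that kernel: at most `2 * q ^ d` zeros lie
in H and at most `q ^ (d + 1) - q ^ d` outside. -/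
theorem ncard_zeros_le {Q : QuadraticForm K V} {d : ℕ} (hd : finrank K V = d + 2)
    (hQ : ∀ U : Submodule K V, (∀ v ∈ U, Q v = 0) → finrank K U ≤ d) :
    {v | Q v = 0}.ncard ≤ Nat.card K ^ (d + 1) + Nat.card K ^ d := by
  have : Finite V := Module.finite_of_finite K
  have hq : 0 < Nat.card K := Nat.card_pos
  by_cases hsing : ∀ x, Q x = 0 → ∀ y, QuadraticMap.polar Q x y = 0
  · let U : Submodule K V :=
      { carrier := {v | Q v = 0}
        zero_mem' := QuadraticMap.map_zero Q
        add_mem' := fun {a b} ha hb ↦ by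
          rw [Set.mem_ofPred_eq] at ha hb ⊢
          rw [QuadraticMap.map_add Q, ha, hb, hsing a ha b, add_zero, add_zero]
        smul_mem' := fun c a ha ↦ by
          rw [Set.mem_ofPred_eq] at ha ⊢
          rw [QuadraticMap.map_smul, ha, smul_zero] }
    have h1 : {v | Q v = 0}.ncard = Nat.card K ^ finrank K U := by
      rw [← Module.natCard_eq_pow_finrank]
      rfl
    rw [h1]
    exact (Nat.pow_le_pow_right hq (hQ U fun v hv ↦ hv)).trans (Nat.le_add_left _ _)
  push Not at hsing
  obtain ⟨x, hx, y, hxy⟩ := hsing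
  set H := LinearMap.ker (Q.polarBilin x) with hH
  have hHr : finrank K H = d + 1 := by
    have h0 : Q.polarBilin x ≠ 0 := fun h ↦ hxy (by simpa using DFunLike.congr_fun h y)
    have h1 := LinearMap.finrank_range_add_finrank_ker (Q.polarBilin x)
    rw [LinearMap.range_eq_top.2 (LinearMap.surjective h0), finrank_top, finrank_self, hd,
      ← hH] at h1
    omega
  obtain ⟨u, hu⟩ : ∃ u : H, (Q.comp H.subtype) u ≠ 0 := by
    by_contra! h
    have := hQ H fun v hv ↦ h ⟨v, hv⟩
    omega
  have h1 := card_mul_ncard_zeros_le hu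
  have h2 := card_mul_ncard_zeros_diff_le hx
  rw [← hH, Set.ncard_compl, Module.natCard_eq_pow_finrank (K := K) (V := V), hd] at h2
  have h3 : (H : Set V).ncard = Nat.card K ^ (d + 1) := by
    rw [← hHr, ← Module.natCard_eq_pow_finrank]
    rfl
  have h4 : ({v | Q v = 0} ∩ (H : Set V)).ncard = {v : H | (Q.comp H.subtype) v = 0}.ncard := by
    rw [← Set.ncard_image_of_injective _ Subtype.val_injective]
    congr 1
    ext v
    simp [and_comm]
  have h5 := Set.ncard_inter_add_ncard_sdiff_eq_ncard {v | Q v = 0} (H : Set V) (Set.toFinite _)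
  rw [Module.natCard_eq_pow_finrank (K := K) (V := H), hHr] at h1
  rw [h3] at h2
  rw [← h5, h4]
  refine Nat.le_of_mul_le_mul_left ?_ hq
  rw [mul_add]
  refine (add_le_add h1 h2).trans ?_
  have h6 : Nat.card K ^ (d + 1) ≤ Nat.card K ^ (d + 2) := Nat.pow_le_pow_right hq (by omega)
  rw [mul_add, ← pow_succ', ← pow_succ']
  simp only [add_assoc, Nat.reduceAdd] at h6 ⊢
  omega

/-- The Witt index is `(d + 2) / 2`, which is at most `d` exactly because `2 ≤ d`. -/
theorem ncard_section_le_of_parabolic {S : Set (ℙ K V)} (hS : IsClassicalPolarSpace .parabolic S)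
    {d : ℕ} (hd : 2 ≤ d) (hV : finrank K V = d + 3) {H : Submodule K V} (hH : IsCoatom H) :
    (vectors S ∩ H).ncard ≤ Nat.card K ^ (d + 1) + Nat.card K ^ d := by
  obtain ⟨Q, -, hw, rfl⟩ := hS
  have hts : ∀ U : Submodule K V, (∀ v ∈ U, Q v = 0) → finrank K U ≤ wittIndex Q := fun U hU ↦
    le_csSup ⟨finrank K V, by rintro _ ⟨U, -, rfl⟩; exact U.finrank_le⟩ ⟨U, hU, rfl⟩
  obtain ⟨φ, hφ, rfl⟩ := exists_dual_ker_eq hH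
  have hHr : finrank K (LinearMap.ker φ) = d + 2 := by
    have h1 := LinearMap.finrank_range_add_finrank_ker φ
    rw [LinearMap.range_eq_top.2 (LinearMap.surjective hφ), finrank_top, finrank_self, hV] at h1
    omega
  have h := ncard_zeros_le (Q := Q.comp (LinearMap.ker φ).subtype) hHr fun U hU ↦ by
    have h1 := hts (U.map (LinearMap.ker φ).subtype) (by
      rintro _ ⟨v, hv, rfl⟩
      exact hU v hv)
    rw [Submodule.finrank_map_subtype_eq] at h1
    omega
  refine le_trans (le_of_eq ?_) h
  rw [vectors_quadricPoints, ← Set.ncard_image_of_injective _ Subtype.val_injective]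
  congr 1
  ext v
  simp [and_comm]

/-- The q + 1 hyperplanes of a pencil cover the space. -/
theorem ncard_le_of_forall_section_le {Z : Set V} {M : ℕ} (hV : 2 ≤ finrank K V)
    (hM : ∀ φ : Dual K V, φ ≠ 0 → (Z ∩ LinearMap.ker φ).ncard ≤ M) :
    Z.ncard ≤ (Nat.card K + 1) * M := by
  classical
  have : Finite V := Module.finite_of_finite K
  have : Fintype K := Fintype.ofFinite K
  have : Nontrivial V := Module.nontrivial_of_finrank_pos (R := K) (by omega)
  obtain ⟨u, hu⟩ := exists_ne (0 : V)
  obtain ⟨φ₀, hφ₀⟩ : ∃ φ : Dual K V, φ u ≠ 0 := by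
    by_contra! h
    exact hu ((Module.forall_dual_apply_eq_zero_iff K u).1 h)
  have hφ₀0 : φ₀ ≠ 0 := fun h ↦ hφ₀ (by rw [h, LinearMap.zero_apply])
  obtain ⟨w, hw, hw0⟩ : ∃ w ∈ LinearMap.ker φ₀, w ≠ 0 := by
    refine Submodule.exists_mem_ne_zero_of_ne_bot fun h ↦ ?_
    have h1 := LinearMap.finrank_range_add_finrank_ker φ₀
    rw [h, LinearMap.range_eq_top.2 (LinearMap.surjective hφ₀0), finrank_top, finrank_self,
      finrank_bot] at h1
    omega
  obtain ⟨φ₁, hφ₁⟩ : ∃ φ : Dual K V, φ w ≠ 0 := by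
    by_contra! h
    exact hw0 ((Module.forall_dual_apply_eq_zero_iff K w).1 h)
  have hcover : Z ⊆ (Z ∩ LinearMap.ker φ₀) ∪
      ⋃ c : K, Z ∩ (LinearMap.ker (φ₁ + c • φ₀) : Set V) := fun v hv ↦ by
    by_cases h : φ₀ v = 0
    · exact Or.inl ⟨hv, h⟩
    · refine Or.inr (Set.mem_iUnion.2 ⟨-φ₁ v / φ₀ v, hv, ?_⟩)
      simp [h]
  refine (Set.ncard_le_ncard hcover).trans ((Set.ncard_union_le _ _).trans ?_)
  rw [add_mul, one_mul, add_comm]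
  refine add_le_add ?_ (hM _ hφ₀0)
  refine (Set.ncard_iUnion_le_of_fintype _).trans ?_
  refine (Finset.sum_le_card_nsmul _ _ M fun c _ ↦ hM _ fun h ↦ hφ₁ ?_).trans ?_
  · have := DFunLike.congr_fun h w
    simpa [LinearMap.mem_ker.1 hw] using this
  · simp

theorem ncard_ne_of_hermitian_of_parabolic {d : ℕ} (hd : 2 ≤ d) (hV : finrank K V = d + 3)
    {S S' : Set (ℙ K V)} (hS : IsClassicalPolarSpace .hermitian S)
    (hS' : IsQuasiPolarSpace .parabolic S') : S'.ncard ≠ S.ncard := fun hcard ↦ by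
  have : Finite V := Module.finite_of_finite K
  obtain ⟨S₀, hS₀, hsec⟩ := hS'
  obtain ⟨σ, B, hσ, hσσ, hB, hnd, rfl⟩ := hS
  obtain ⟨s, hs, hle⟩ := le_card_hermitian hσ hσσ hB hnd
  have hZ : (vectors S').ncard = {v | B v v = 0}.ncard := by
    rw [← vectors_isotropicPoints, ncard_vectors, ncard_vectors, hcard]
  have hM := ncard_le_of_forall_section_le (K := K) (Z := vectors S') (by omega) fun φ hφ ↦ by
    obtain ⟨H₀, hH₀, h⟩ := hsec _ (isCoatom_ker hφ)
    have := ncard_section_le_of_parabolic hS₀ hd hV hH₀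
    rwa [← vectors_inter_projectivization, ncard_vectors, ← h, ← ncard_vectors,
      vectors_inter_projectivization] at this
  rw [hZ, hs] at hM
  obtain ⟨j, rfl⟩ := Nat.exists_eq_add_of_le hd
  rw [hV] at hle
  have hs2 : 2 ≤ s := by
    have := Finite.one_lt_card (α := K)
    rw [hs] at this
    by_contra! h
    interval_cases s <;> simp at this
  have hX : 0 < s ^ j := by positivity
  have h1 := hle.trans (Nat.add_le_add_right (Nat.mul_le_mul_left s hM) _)
  have h2 : s ^ (j + 5) * (s ^ j * s ^ 5) ≤ s ^ (j + 5) * (s ^ j * (s ^ 2 + 1) ^ 2 + (s - 1)) := by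
    refine le_trans (le_of_eq ?_) (h1.trans (le_of_eq ?_))
    · ring
    · ring
  have h3 := Nat.le_of_mul_le_mul_left h2 (by positivity)
  have h4 : s ^ j * s ^ 5 ≤ s ^ j * ((s ^ 2 + 1) ^ 2 + s) := by
    refine h3.trans ?_
    rw [mul_add]
    refine Nat.add_le_add_left ?_ _
    calc s - 1 ≤ s := Nat.sub_le _ _
      _ ≤ s ^ j * s := Nat.le_mul_of_pos_left _ hX
  have h5 := Nat.le_of_mul_le_mul_left h4 hX
  -- It remains to refute `s ^ 5 ≤ (s ^ 2 + 1) ^ 2 + s` for `s ≥ 2`; at `s = 2` it reads 32 ≤ 27.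
  obtain ⟨r, rfl⟩ := Nat.exists_eq_add_of_le hs2
  ring_nf at h5
  have : 0 ≤ r ^ 5 := Nat.zero_le _
  nlinarith [Nat.zero_le (r ^ 2), Nat.zero_le (r ^ 3), Nat.zero_le (r ^ 4)]

end Bounds

end QuasiPolar


namespace QuasiPolar

/-! ### The four types together -/

section Classical

/-- The number of sizes of hyperplane sections of a polar space, for parabolic quadrics in odd
characteristic. -/
def PolarType.sectionCount : PolarType → ℕ
  | .parabolic => 3
  | _ => 2

universe u v

variable {K : Type u} {V : Type v} [Field K] [Finite K] [AddCommGroup V] [Module K V]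
  [FiniteDimensional K V]

theorem IsClassicalPolarSpace.exists_isPolarModel {T : PolarType} {S : Set (ℙ K V)}
    (hS : IsClassicalPolarSpace T S) (hT : T = .parabolic → Odd (Nat.card K)) :
    ∃ (k : Type u) (_ : Field k) (_ : Finite k) (σ : K →+* K) (β : V →ₛₗ[σ] V →ₗ[K] K)
      (h : V → k) (val : k → ℂ), IsPolarModel β h val (vectors S) ∧
        (Set.range val).ncard = T.sectionCount := by
  cases T with
  | elliptic =>
    obtain ⟨Q, hQ, hV, rfl⟩ := hS
    obtain ⟨val, M, hval⟩ := exists_isPolarModel_of_even hQ (by rw [hV]; exact even_two_mul _)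
    exact ⟨K, _, ‹_›, _, _, _, val, by rwa [vectors_quadricPoints], hval⟩
  | hyperbolic =>
    obtain ⟨Q, hQ, hV, rfl⟩ := hS
    obtain ⟨val, M, hval⟩ := exists_isPolarModel_of_even hQ (by rw [hV]; exact even_two_mul _)
    exact ⟨K, _, ‹_›, _, _, _, val, by rwa [vectors_quadricPoints], hval⟩
  | parabolic =>
    obtain ⟨Q, hQ, hV, rfl⟩ := hS
    have h2 : ringChar K ≠ 2 := fun h2 ↦ by
      have : Fintype K := Fintype.ofFinite K
      have h1 := FiniteField.even_card_iff_char_two.1 h2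
      rw [← Nat.card_eq_fintype_card, ← Nat.even_iff] at h1
      exact Nat.not_even_iff_odd.2 (hT rfl) h1
    obtain ⟨val, M, hval⟩ := exists_isPolarModel_of_odd hQ h2 ⟨_, hV⟩
    exact ⟨K, _, ‹_›, _, _, _, val, by rwa [vectors_quadricPoints], hval⟩
  | hermitian =>
    obtain ⟨σ, B, hσ, hσσ, hB, hnd, rfl⟩ := hS
    obtain ⟨val, M, hval⟩ := exists_isPolarModel_hermitian hσ hσσ hB hnd
    exact ⟨fixedSubfield σ, _, inferInstance, _, _, _, val, by rwa [vectors_isotropicPoints], hval⟩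

theorem IsQuasiPolarSpace.exists_section_values {T : PolarType} {S : Set (ℙ K V)}
    (hS : IsQuasiPolarSpace T S) (hT : T = .parabolic → Odd (Nat.card K)) :
    ∃ A : Set ℂ, A.Finite ∧ A.ncard = T.sectionCount ∧ ∀ φ : Dual K V, φ ≠ 0 →
      ((vectors S ∩ LinearMap.ker φ).ncard : ℂ) ∈ A := by
  have : Finite V := Module.finite_of_finite K
  obtain ⟨S₀, hS₀, hsec⟩ := hS
  obtain ⟨k, _, _, σ, β, h, val, M, hval⟩ := hS₀.exists_isPolarModel hT
  refine ⟨Set.range val, Set.finite_range val, hval, fun φ hφ ↦ ?_⟩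
  obtain ⟨H₀, hH₀, hcard⟩ := hsec _ (isCoatom_ker hφ)
  obtain ⟨φ₀, hφ₀, rfl⟩ := exists_dual_ker_eq hH₀
  obtain ⟨y, rfl⟩ := M.exists_apply_eq φ₀
  have hy : y ≠ 0 := fun hy ↦ hφ₀ (by rw [hy, map_zero])
  rw [← vectors_inter_projectivization, ncard_vectors, hcard, ← ncard_vectors,
    vectors_inter_projectivization, M.ncard_section y hy]
  exact ⟨_, rfl⟩

/-- A quasi-polar space with as many points as a classical polar space has at most as many
hyperplane section sizes. -/
theorem IsQuasiPolarSpace.exists_section_values_of_ncard_eq {m : ℕ} (hm : 3 ≤ m)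
    (hV : finrank K V = m + 1) {T T' : PolarType} (hT : T = .parabolic → Odd (Nat.card K))
    {S S' : Set (ℙ K V)} (hS : IsClassicalPolarSpace T S) (hS' : IsQuasiPolarSpace T' S')
    (hcard : S'.ncard = S.ncard) :
    ∃ A : Set ℂ, A.Finite ∧ A.ncard ≤ T.sectionCount ∧ ∀ φ : Dual K V, φ ≠ 0 →
      ((vectors S' ∩ LinearMap.ker φ).ncard : ℂ) ∈ A := by
  -- Parabolic type forces `m + 1` odd, which rules out elliptic and hyperbolic `T`. It also gives
  -- `m ≥ 4`, hence `d = m - 2 ≥ 2` in the Hermitian case.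
  have hodd : T' = .parabolic → T = .parabolic := by
    rintro rfl
    have hS'₀ := hS'
    obtain ⟨S₀, ⟨Q₀, -, h₀, -⟩, -⟩ := hS'₀
    cases T with
    | elliptic =>
      obtain ⟨Q, -, h, -⟩ := hS
      omega
    | hyperbolic =>
      obtain ⟨Q, -, h, -⟩ := hS
      omega
    | parabolic => rfl
    | hermitian =>
      exact absurd hcard
        (ncard_ne_of_hermitian_of_parabolic (d := m - 2) (by omega) (by omega) hS hS')
  obtain ⟨A, hA, hAcard, hAmem⟩ := hS'.exists_section_values fun h ↦ hT (hodd h)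
  refine ⟨A, hA, hAcard.trans_le ?_, hAmem⟩
  cases T' with
  | parabolic => rw [hodd rfl]
  | _ => cases T <;> simp [PolarType.sectionCount]

end Classical

end QuasiPolar

/-! ### The proposition -/

theorem mainTheorem1 {K V : Type*} [Field K] [Finite K] [AddCommGroup V] [Module K V]
    [FiniteDimensional K V] (m : ℕ) (hm : 3 ≤ m) (hV : Module.finrank K V = m + 1)
    (T T' : QuasiPolar.PolarType) (hT : T = .parabolic → Odd (Nat.card K))
    (S S' : Set (ℙ K V)) (π : Submodule K V) (P : ℙ K V)
    (hS : QuasiPolar.IsClassicalPolarSpace T S)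
    (hπ : QuasiPolar.IsSingularHyperplane T S π P)
    (hS' : QuasiPolar.IsQuasiPolarSpace T' S')
    (hcard : S'.ncard = S.ncard)
    (hswitch : QuasiPolar.IsSwitching S S' π) :
    (∃ W : Submodule K V, QuasiPolar.IsBaseSpace π P W ∧
      ∃ B' : Set (ℙ K W), QuasiPolar.IsQuasiPolarSpace T B' ∧
        (∃ C : Set (ℙ K W), QuasiPolar.IsClassicalPolarSpace T C ∧ B'.ncard = C.ncard) ∧
        S' ∩ π.projectivization = QuasiPolar.cone P W B') ∧
    QuasiPolar.IsPivoting T S S' π P := by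
  obtain ⟨hco, W, hW, B, hB, hcone⟩ := hπ
  obtain ⟨R, R', hR, hR', hSS'⟩ := hswitch
  obtain ⟨A', hA', hA'card, hA'mem⟩ :=
    hS'.exists_section_values_of_ncard_eq hm hV hT hS hcard
  obtain ⟨k, _, _, σ, β, h, val, M, hval⟩ := hS.exists_isPolarModel hT
  have hdiff : S' \ π.projectivization = S \ π.projectivization := by
    ext p
    rw [hSS', Set.mem_sdiff, Set.mem_sdiff, Set.mem_union, Set.mem_sdiff]
    constructor
    · rintro ⟨⟨hp, -⟩ | hp, hpπ⟩
      · exact ⟨hp, hpπ⟩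
      · exact absurd (hR' hp) hpπ
    · rintro ⟨hp, hpπ⟩
      exact ⟨Or.inl ⟨hp, fun hpR ↦ hpπ (hR hpR)⟩, hpπ⟩
  obtain ⟨B', hB', hB'card, hsec⟩ :=
    M.exists_cone hco hW hcone hcard hdiff hA' (hA'card.trans_eq hval.symm) hA'mem
  refine ⟨⟨W, hW, B', ⟨B, hB, hsec⟩, ⟨B, hB, hB'card⟩, hB'⟩,
    W, hW, B, B', hB, hcone, ⟨B, hB, hsec⟩, ?_⟩
  rw [← hcone, ← hB']
  ext p
  have := Set.ext_iff.1 hdiff p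
  simp only [Set.mem_sdiff, Set.mem_union, Set.mem_inter_iff] at this ⊢
  tauto
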